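/- Let $d,\alpha\ge 1$, $\gamma>0$, let $\mathbb A$ be a Borel space with a probability measure $\Theta$, and for $1\le j\le\alpha$ let $\varphi_j:(\mathbb R^d\times\mathbb A)^{j+1}\to[0,1]$ be measurable, symmetric, and translation-invariant, i.e. $\varphi_j((x_0+s,a_0),\dots,(x_j+s,a_j))=\varphi_j((x_0,a_0),\dots,(x_j,a_j))$ for all $s\in\mathbb R^d$. **The random complex.** Let $\mathbb M=\prod_{j=1}^{\alpha}[0,1]^{(\mathbb N\times\mathbb N)^{j}}$, let $\mathbb Q$ be the law on $\mathbb M$ under which all components are independent and uniform on $[0,1]$, and let $\Psi$ be a Poisson process on $\mathbb R^d\times\mathbb A\times[0,1]\times\mathbb M$ with intensity measure $\gamma\lambda_d\otimes\Theta\otimes\mathcal U([0,1])\otimes\mathbb Q$. Fix an enumeration $z_0=\mathbf 0,z_1,z_2,\dots$ of $\mathbb Z^d$ and put $Q_k=[0,1)^d+z_k$. For a locally finite counting measure $\psi$ on this space, a point $(x,a,t,u)$ of $\psi$ with $x\in Q_k$ that is the $i$-th smallest in its third component among the points of $\psi$ over $Q_k$ has coordinates $(k,i)$ in $\psi$. For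 points $p_0,\dots,p_j$ of $\psi$, $p_i=(x_i,a_i,t_i,u^{(i)})$, with $t_0<\dots<t_j$, $1\le j\le\alpha$, let $u(\{p_0,\dots,p_j\})$ be the component of $u^{(j)}$ indexed by the coordinates of $p_0,\dots,p_{j-1}$. Let $T(\psi)$ be the simplicial complex whose vertices are the $(x,a)$ for points $(x,a,t,u)$ of $\psi$, and in which at most $\alpha+1$ points span a simplex if and only if $u(\rho)\le\varphi_{|\rho|-1}(\rho)$ for every subset $\rho$ of them with $|\rho|\ge2$, where $\varphi_{|\rho|-1}(\rho)$ is evaluated at the vertices of $\rho$. **The difference operator.** Let $V\sim\Theta$ and $U\sim\mathbb Q$ be such that $V,U,\Psi$ are independent, and let $\Delta^{\mathbf 0}=T(\Psi+\delta_{(\mathbf 0,V,1,U)})$. For $W\subseteq\mathbb R^d$ let $\Delta^{\mathbf 0}_W$ be the subcomplex of the simplices with vertices in $W\times\mathbb A$. For a real function $f$ of finite simplicial complexes with vertices in $\mathbb R^d\times\mathbb A$ and a bounded Borel set $W$ put $$\Lambda f(\Delta_W)=f(\Delta^{\mathbf 0}_W)-f(\Delta^{\mathbf 0}_{W\setminus\{\mathbf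 0\}}).$$ The function $f$ is *weakly stabilizing* if it is invariant under translations of the Euclidean components of the vertices and there is a real random variable $Z$ such that $\Lambda f(\Delta_{W_n})\to Z$ in probability for all sequences $(W_n)$ of half-open cubes (sets $\prod_{i=1}^d[c_i,c_i+r)$, $r>0$) such that every bounded set is contained in $W_n$ for all large $n$. It satisfies the *moment condition* if there is $\varepsilon>0$ with $$\sup_{W\text{ a half-open cube},\ \mathbf 0\in W}\mathbb E\big[|\Lambda f(\Delta_W)|^{2+\varepsilon}\big]<\infty .$$ **Statement.** Let $\pi(a)=\gamma\int_{\mathbb R^d}\int_{\mathbb A}\varphi_1((\mathbf 0,a),(y,b))\,\Theta(db)\,dy$, and suppose that $\mathbb E[\pi(V)^{3\alpha}]<\infty$. Then the Euler characteristic $\chi(K)=\sum_{i=0}^{\dim K}(-1)^i f_i(K)$, where $f_i(K)$ is the number of $i$-simplices of the finite complex $K$, is weakly stabilizing and satisfies the moment condition. -/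

import Mathlib

open MeasureTheory ProbabilityTheory Filter
open scoped ENNReal NNReal Topology

noncomputable section

namespace RCM

/-! ### Finite simplicial complexes and functionals of them -/

section Complexes

variable {X : Type*}

/-- `f_j(K)`, the number of `j`-simplices of a (finite) complex `K`. -/
def simplexCount (K : PreAbstractSimplicialComplex X) (j : ℕ) : ℕ :=
  {σ ∈ K.faces | σ.card = j + 1}.ncard

/-- The dimension of a finite complex: the largest dimension of a simplex
(`0` for the empty complex, where it plays no role). -/
def complexDim (K : PreAbstractSimplicialComplex X) : ℕ :=
  sSup ((fun σ : Finset X => σ.card - 1) '' K.faces)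

/-- The Euler characteristic `χ(K) = ∑_{i=0}^{dim K} (-1)^i f_i(K)` of a finite complex `K`.
(Functionals are total functions on complexes, but are only ever used on finite complexes.) -/
def eulerChar (K : PreAbstractSimplicialComplex X) : ℝ :=
  ∑ i ∈ Finset.range (complexDim K + 1), (-1 : ℝ) ^ i * (simplexCount K i : ℝ)

/-- The subcomplex of all simplices with vertices in `S`. -/
def restrictTo (K : PreAbstractSimplicialComplex X) (S : Set X) :
    PreAbstractSimplicialComplex X where
  faces := {σ ∈ K.faces | ∀ v ∈ σ, v ∈ S}
  isRelLowerSet_faces := by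
    intro σ hσ
    refine ⟨(K.isRelLowerSet_faces hσ.1).1, fun τ hτ hne => ?_⟩
    exact ⟨(K.isRelLowerSet_faces hσ.1).2 hτ hne, fun v hv => hσ.2 v (hτ hv)⟩

end Complexes

/-! ### Point processes on `ℝ^d × 𝔹` -/

/-- `ℝ^d` with the Euclidean norm, its Borel sets and Lebesgue measure. -/
abbrev Space (d : ℕ) : Type := EuclideanSpace ℝ (Fin d)

/-- Counting measures: countable sums of Dirac measures. (On a standard Borel space the locally
finite ones are exactly the locally finite measures with values in `{0, 1, 2, …, ∞}`.) -/
def IsCountingMeasure {X : Type*} [MeasurableSpace X] (η : Measure X) : Prop :=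
  ∃ (ι : Type) (_ : Countable ι) (x : ι → X), η = Measure.sum fun i => Measure.dirac (x i)

/-- A measure on `ℝ^d × 𝔹` is locally finite if `η (B × 𝔹) < ∞` for bounded Borel sets `B`. -/
def IsLocFinite {d : ℕ} {𝔹 : Type*} [MeasurableSpace 𝔹] (η : Measure (Space d × 𝔹)) : Prop :=
  ∀ B : Set (Space d), MeasurableSet B → Bornology.IsBounded B → η (B ×ˢ Set.univ) < ∞

/-- The Poisson distribution with parameter `m ∈ [0, ∞]`, as a law on `[0, ∞]`; the parameter `∞`
gives the constant `∞`. -/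
def poissonLaw (m : ℝ≥0∞) : Measure ℝ≥0∞ :=
  open Classical in
  if m = ∞ then Measure.dirac ∞
  else (poissonMeasure m.toNNReal).map fun n : ℕ => (n : ℝ≥0∞)

/-- `Ψ` is a Poisson process on `ℝ^d × 𝔹` with intensity measure `μ`. The measurable structure on
the space of measures is the one generated by the evaluations `η ↦ η B`, `B` measurable. -/
structure IsPoissonProcess {d : ℕ} {𝔹 Ω : Type*} [MeasurableSpace 𝔹] [MeasurableSpace Ω]
    (Ψ : Ω → Measure (Space d × 𝔹)) (μ : Measure (Space d × 𝔹)) (P : Measure Ω) : Prop where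
  measurable : Measurable Ψ
  counting : ∀ ω, IsCountingMeasure (Ψ ω)
  locFinite : ∀ ω, IsLocFinite (Ψ ω)
  law : ∀ B, MeasurableSet B → P.map (fun ω => Ψ ω B) = poissonLaw (μ B)
  indep : ∀ (m : ℕ) (B : Fin m → Set (Space d × 𝔹)), (∀ i, MeasurableSet (B i)) →
    Pairwise (Function.onFun Disjoint B) → iIndepFun (fun i ω => Ψ ω (B i)) P

/-! ### The random complex -/

/-- The space `𝕄 = M^(2) × ⋯ × M^(2α)`, where `M^(2j)` is the space of families in `[0,1]` indexed
by `j` pairs of natural numbers, `1 ≤ j ≤ α`. Here `k : Fin α` stands for `j = k + 1`. -/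
abbrev Decor (α : ℕ) : Type :=
  (Σ k : Fin α, (Fin ((k : ℕ) + 1) → ℕ × ℕ)) → unitInterval

/-- The law `ℚ` on `𝕄`: all components are independent and uniform on `[0,1]`. -/
def decorLaw (α : ℕ) : Measure (Decor α) :=
  Measure.infinitePi fun _ => (volume : Measure unitInterval)

/-- Points `(x, a, t, u)` of `ℝ^d × 𝔸 × [0,1] × 𝕄`. -/
abbrev Pt (d : ℕ) (𝔸 : Type*) (α : ℕ) : Type _ :=
  Space d × (𝔸 × (unitInterval × Decor α))

section Model

variable {d : ℕ} {𝔸 : Type*} {α : ℕ}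

/-- The vertex `(x, a)` of the point `(x, a, t, u)`. -/
def Pt.vertex (y : Pt d 𝔸 α) : Space d × 𝔸 := (y.1, y.2.1)

/-- The component `t` of the point `(x, a, t, u)`. -/
def Pt.time (y : Pt d 𝔸 α) : unitInterval := y.2.2.1

/-- The component `u` of the point `(x, a, t, u)`. -/
def Pt.decor (y : Pt d 𝔸 α) : Decor α := y.2.2.2

/-- The points (atoms) of a counting measure. -/
def points {X : Type*} [MeasurableSpace X] (ψ : Measure X) : Set X := {y | ψ {y} ≠ 0}

/-- The index `k` of the cube `Q_k = [0,1)^d + z_k` that contains `x`, where `z_0, z_1, …` is the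
enumeration `enum` of `ℤ^d`. -/
def cubeIndex (enum : ℕ ≃ (Fin d → ℤ)) (x : Space d) : ℕ := enum.symm fun i => ⌊x i⌋

/-- The coordinates `(k, i)` of the point `y` inside `ψ`: `y` lies over the cube `Q_k`, and it
is the `i`-th smallest point of `ψ` over this cube with respect to the time component. -/
def coords [MeasurableSpace 𝔸] (enum : ℕ ≃ (Fin d → ℤ)) (ψ : Measure (Pt d 𝔸 α))
    (y : Pt d 𝔸 α) : ℕ × ℕ :=
  (cubeIndex enum y.1,
    {z ∈ points ψ | cubeIndex enum z.1 = cubeIndex enum y.1 ∧ Pt.time z ≤ Pt.time y}.ncard)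

/-- Measurable, symmetric, translation-invariant connection functions `φ_1, …, φ_α`, where
`φ_j : (ℝ^d × 𝔸)^{j+1} → [0,1]`. The values of `φ` at other indices are never used. -/
structure IsConnectionFamily [MeasurableSpace 𝔸] (α : ℕ)
    (φ : (j : ℕ) → (Fin (j + 1) → Space d × 𝔸) → unitInterval) : Prop where
  measurable : ∀ j, 1 ≤ j → j ≤ α → Measurable (φ j)
  symmetric : ∀ j, 1 ≤ j → j ≤ α → ∀ (τ : Equiv.Perm (Fin (j + 1))) (v : Fin (j + 1) → Space d × 𝔸),
    φ j (v ∘ τ) = φ j v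
  translation_invariant : ∀ j, 1 ≤ j → j ≤ α → ∀ (s : Space d) (v : Fin (j + 1) → Space d × 𝔸),
    φ j (fun i => ((v i).1 + s, (v i).2)) = φ j v

/-- The points `p 0, …, p j` of `ψ`, ordered by strictly increasing time and with distinct vertices,
span a simplex: for every `ρ ⊆ {p 0, …, p j}` with `k + 2 ≥ 2` elements
(given by the increasing map `s`), `u(ρ) ≤ φ_{k+1}(ρ)`. Here `u(ρ)` is the component of the
decoration of the latest point of `ρ` at the index formed by the coordinates of the other points. -/
def IsOrderedSimplex [MeasurableSpace 𝔸] (enum : ℕ ≃ (Fin d → ℤ))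
    (φ : (j : ℕ) → (Fin (j + 1) → Space d × 𝔸) → unitInterval)
    (ψ : Measure (Pt d 𝔸 α)) {j : ℕ} (p : Fin (j + 1) → Pt d 𝔸 α) : Prop :=
  (∀ i, p i ∈ points ψ) ∧ StrictMono (fun i => Pt.time (p i)) ∧
  Function.Injective (fun i => Pt.vertex (p i)) ∧
  ∀ (k : Fin α) (s : Fin ((k : ℕ) + 1 + 1) ↪o Fin (j + 1)),
    Pt.decor (p (s (Fin.last ((k : ℕ) + 1)))) ⟨k, fun i => coords enum ψ (p (s i.castSucc))⟩
      ≤ φ ((k : ℕ) + 1) (fun i => Pt.vertex (p (s i)))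

lemma IsOrderedSimplex.comp [MeasurableSpace 𝔸] {enum : ℕ ≃ (Fin d → ℤ)}
    {φ : (j : ℕ) → (Fin (j + 1) → Space d × 𝔸) → unitInterval}
    {ψ : Measure (Pt d 𝔸 α)} {j m : ℕ} {p : Fin (j + 1) → Pt d 𝔸 α}
    (hp : IsOrderedSimplex enum φ ψ p) (e : Fin (m + 1) ↪o Fin (j + 1)) :
    IsOrderedSimplex enum φ ψ (p ∘ e) :=
  ⟨fun i => hp.1 (e i), fun _ _ h => hp.2.1 (e.strictMono h),
    fun _ _ h => e.injective (hp.2.2.1 h), fun k s => hp.2.2.2 k (s.trans e)⟩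

/-- The simplicial complex `T(ψ)` (of dimension at most `α`) with vertices in `ℝ^d × 𝔸`
constructed from a counting measure `ψ` on `ℝ^d × 𝔸 × [0,1] × 𝕄`. -/
def complexOf [MeasurableSpace 𝔸] (enum : ℕ ≃ (Fin d → ℤ))
    (φ : (j : ℕ) → (Fin (j + 1) → Space d × 𝔸) → unitInterval)
    (ψ : Measure (Pt d 𝔸 α)) : PreAbstractSimplicialComplex (Space d × 𝔸) where
  faces := {σ | ∃ j ≤ α, ∃ p : Fin (j + 1) → Pt d 𝔸 α,
    IsOrderedSimplex enum φ ψ p ∧ (σ : Set (Space d × 𝔸)) = Set.range fun i => Pt.vertex (p i)}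
  isRelLowerSet_faces := by
    classical
    rintro σ ⟨j, hj, p, hp, hσ⟩
    refine ⟨?_, fun τ hτ hne => ?_⟩
    · rw [← Finset.coe_nonempty, hσ]
      exact Set.range_nonempty _
    · set S : Finset (Fin (j + 1)) := Finset.univ.filter fun i => Pt.vertex (p i) ∈ τ with hS
      have hSne : S.Nonempty := by
        obtain ⟨v, hv⟩ := hne
        have : v ∈ Set.range fun i => Pt.vertex (p i) := hσ ▸ Finset.mem_coe.2 (hτ hv)
        obtain ⟨i, rfl⟩ := this
        exact ⟨i, by simpa [hS] using hv⟩
      obtain ⟨m, hm⟩ : ∃ m, S.card = m + 1 :=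
        ⟨S.card - 1, (Nat.succ_pred_eq_of_pos hSne.card_pos).symm⟩
      have hmj : m ≤ j := by
        have := S.card_le_univ
        simp only [Fintype.card_fin] at this
        omega
      refine ⟨m, hmj.trans hj, p ∘ S.orderEmbOfFin hm, hp.comp _, ?_⟩
      ext v
      constructor
      · intro hv
        have : v ∈ Set.range fun i => Pt.vertex (p i) := hσ ▸ Finset.mem_coe.2 (hτ hv)
        obtain ⟨i, rfl⟩ := this
        have hi : i ∈ Set.range (S.orderEmbOfFin hm) := by
          rw [Finset.range_orderEmbOfFin]
          simpa [hS] using hv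
        obtain ⟨l, rfl⟩ := hi
        exact ⟨l, rfl⟩
      · rintro ⟨l, rfl⟩
        have hl : S.orderEmbOfFin hm l ∈ S := S.orderEmbOfFin_mem hm l
        exact Finset.mem_coe.2 (Finset.mem_filter.1 hl).2

/-- The difference operator `Λ_{(x,a,t,u)} f(Δ_W)` for the complex `Δ = T(ψ)` and the added point
`y = (x,a,t,u)`: with `Δ' = T(ψ + δ_y)`, it is `f(Δ'_W) - f(Δ'_{W \ {x}})`, where `Δ'_W` consists
of the simplices of `Δ'` with vertices in `W × 𝔸`. -/
def diffOp [MeasurableSpace 𝔸] (enum : ℕ ≃ (Fin d → ℤ))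
    (φ : (j : ℕ) → (Fin (j + 1) → Space d × 𝔸) → unitInterval)
    (f : PreAbstractSimplicialComplex (Space d × 𝔸) → ℝ)
    (ψ : Measure (Pt d 𝔸 α)) (y : Pt d 𝔸 α) (W : Set (Space d)) : ℝ :=
  f (restrictTo (complexOf enum φ (ψ + Measure.dirac y)) (W ×ˢ Set.univ)) -
    f (restrictTo (complexOf enum φ (ψ + Measure.dirac y)) ((W \ {y.1}) ×ˢ Set.univ))

/-- `Λ_{(0,V,1,U)} f(Δ_W)` as a function on the probability space. -/
def diffOpOrigin [MeasurableSpace 𝔸] {Ω : Type*} (enum : ℕ ≃ (Fin d → ℤ))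
    (φ : (j : ℕ) → (Fin (j + 1) → Space d × 𝔸) → unitInterval)
    (Ψ : Ω → Measure (Pt d 𝔸 α)) (V : Ω → 𝔸) (U : Ω → Decor α)
    (f : PreAbstractSimplicialComplex (Space d × 𝔸) → ℝ) (W : Set (Space d)) (ω : Ω) : ℝ :=
  diffOp enum φ f (Ψ ω) (0, V ω, 1, U ω) W

/-- Half-open cubes `∏ [c_i, c_i + r)`, `r > 0`. -/
def IsCube (W : Set (Space d)) : Prop :=
  ∃ (c : Space d) (r : ℝ), 0 < r ∧ W = {x | ∀ i, c i ≤ x i ∧ x i < c i + r}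

/-- `W_n → ℝ^d`: every bounded set is contained in `W_n` for all large `n`. -/
def TendsToSpace (W : ℕ → Set (Space d)) : Prop :=
  ∀ B : Set (Space d), Bornology.IsBounded B → ∃ N, ∀ n ≥ N, B ⊆ W n

open Classical in
/-- `K + s`: all Euclidean components of vertices are translated by `s`. -/
def translate (K : PreAbstractSimplicialComplex (Space d × 𝔸)) (s : Space d) :
    PreAbstractSimplicialComplex (Space d × 𝔸) :=
  K.map fun v => (v.1 + s, v.2)

/-- `f(K) = f(K + s)` for all finite complexes `K` and all `s ∈ ℝ^d`. -/
def IsTranslationInvariant (f : PreAbstractSimplicialComplex (Space d × 𝔸) → ℝ) : Prop :=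
  ∀ (K : PreAbstractSimplicialComplex (Space d × 𝔸)) (s : Space d), K.faces.Finite →
    f K = f (translate K s)

/-- `f` is weakly stabilizing: it is translation-invariant, the `Λ_{(0,V,1,U)} f(Δ_W)` are random
variables, and there is one random variable `Z` to which `Λ_{(0,V,1,U)} f(Δ_{W_n})` converges in
probability for every sequence of cubes with `W_n → ℝ^d`. -/
def IsWeaklyStabilizing [MeasurableSpace 𝔸] {Ω : Type*} [MeasurableSpace Ω] (P : Measure Ω)
    (enum : ℕ ≃ (Fin d → ℤ)) (φ : (j : ℕ) → (Fin (j + 1) → Space d × 𝔸) → unitInterval)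
    (Ψ : Ω → Measure (Pt d 𝔸 α)) (V : Ω → 𝔸) (U : Ω → Decor α)
    (f : PreAbstractSimplicialComplex (Space d × 𝔸) → ℝ) : Prop :=
  IsTranslationInvariant f ∧
  (∀ W, IsCube W → AEMeasurable (diffOpOrigin enum φ Ψ V U f W) P) ∧
  ∃ Z : Ω → ℝ, Measurable Z ∧
    ∀ W : ℕ → Set (Space d), (∀ n, IsCube (W n)) → TendsToSpace W →
      TendstoInMeasure P (fun n => diffOpOrigin enum φ Ψ V U f (W n)) atTop Z

/-- The moment condition: for some `ε > 0`, the supremum of `𝔼 |Λ_{(0,V,1,U)} f(Δ_W)|^{2+ε}` over all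
cubes `W` that contain the origin is finite. -/
def SatisfiesMomentCondition [MeasurableSpace 𝔸] {Ω : Type*} [MeasurableSpace Ω] (P : Measure Ω)
    (enum : ℕ ≃ (Fin d → ℤ)) (φ : (j : ℕ) → (Fin (j + 1) → Space d × 𝔸) → unitInterval)
    (Ψ : Ω → Measure (Pt d 𝔸 α)) (V : Ω → 𝔸) (U : Ω → Decor α)
    (f : PreAbstractSimplicialComplex (Space d × 𝔸) → ℝ) : Prop :=
  (∀ W, IsCube W → (0 : Space d) ∈ W → AEMeasurable (diffOpOrigin enum φ Ψ V U f W) P) ∧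
  ∃ ε : ℝ, 0 < ε ∧
    ⨆ (W : Set (Space d)) (_ : IsCube W) (_ : (0 : Space d) ∈ W),
      ∫⁻ ω, ‖diffOpOrigin enum φ Ψ V U f W ω‖ₑ ^ (2 + ε) ∂P < ∞

/-- The mixing parameter `π(a) = γ ∫_{ℝ^d} ∫_𝔸 φ_1((0,a),(y,b)) Θ(db) dy ∈ [0, ∞]`. -/
def mixingParam [MeasurableSpace 𝔸] (γ : ℝ) (Θ : Measure 𝔸)
    (φ : (j : ℕ) → (Fin (j + 1) → Space d × 𝔸) → unitInterval) (a : 𝔸) : ℝ≥0∞ :=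
  ENNReal.ofReal γ * ∫⁻ y : Space d, ∫⁻ b : 𝔸, ENNReal.ofReal (φ 1 ![(0, a), (y, b)] : ℝ) ∂Θ

/-- The intensity measure `γ λ_d ⊗ Θ ⊗ 𝒰([0,1]) ⊗ ℚ` on `ℝ^d × 𝔸 × [0,1] × 𝕄`. -/
def intensity [MeasurableSpace 𝔸] (d α : ℕ) (γ : ℝ) (Θ : Measure 𝔸) : Measure (Pt d 𝔸 α) :=
  (ENNReal.ofReal γ • (volume : Measure (Space d))).prod
    (Θ.prod ((volume : Measure unitInterval).prod (decorLaw α)))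

end Model

end RCM

end

noncomputable section

namespace RCM

/-! ### The exponential function on `[0, ∞]` -/

/-! Almost surely no point of the Poisson process lies over the origin. Deleting the origin from `W`
then removes exactly the simplices containing the added vertex, and `Λχ(Δ_W)` is the alternating
count of these simplices (`HasDistinctTimes.diffOp_eulerChar`). Since the added point has the
maximal time `1`, every other vertex of such a simplex is a neighbour of the origin, and the edge is
decided by one component of `U` (`HasDistinctTimes.exists_neighbour`). With `D` neighbours there are
at most `D ^ i` such `i`-simplices, hence `|Λχ(Δ_W)| ≤ (1 + D) ^ α` uniformly in `W`.

Given the mark `a`, the number `D` is a sum of independent indicators over the Poisson points with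
mean `π(a)`. Its exponential moments yield `𝔼[D ^ m | a] ≤ C_m (1 + π(a)) ^ m`
(`lintegral_lintegral_degree_pow_le`), so `D` has a finite moment of order `3α`. This gives the
moment condition with `ε = 1`. It also makes `D` almost surely finite, and as soon as `W` contains
the origin and all its neighbours the difference operator no longer changes.

The remaining work is measurability. Almost surely the times over each unit cube are distinct, and
the configuration is encoded by its `record`, the family of its points indexed by coordinates. This
`record` is measurable and turns simplex counts into countable operations
(`HasDistinctTimes.setOf_faces_eq`, `measurable_ncard_exists`). -/

/-- The exponential function on `[0, ∞]`. -/
def eexp (x : ℝ≥0∞) : ℝ≥0∞ := EReal.exp x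

lemma eexp_coe (x : ℝ≥0) : eexp x = ENNReal.ofReal (Real.exp x) := rfl

@[simp] lemma eexp_zero : eexp 0 = 1 := by simp [eexp]

@[simp] lemma eexp_top : eexp ∞ = ∞ := by simp [eexp]

lemma eexp_add (x y : ℝ≥0∞) : eexp (x + y) = eexp x * eexp y := by
  simp [eexp, EReal.exp_add]

lemma eexp_mono : Monotone eexp := fun _ _ h =>
  EReal.exp_monotone (EReal.coe_ennreal_le_coe_ennreal_iff.2 h)

lemma measurable_eexp : Measurable eexp := eexp_mono.measurable

lemma eexp_sum {ι : Type*} (s : Finset ι) (f : ι → ℝ≥0∞) :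
    eexp (∑ i ∈ s, f i) = ∏ i ∈ s, eexp (f i) := by
  classical
  induction s using Finset.induction_on with
  | empty => simp
  | insert i s hi ih => rw [Finset.sum_insert hi, Finset.prod_insert hi, eexp_add, ih]

lemma one_add_le_eexp (x : ℝ≥0∞) : 1 + x ≤ eexp x := by
  induction x with
  | top => simp
  | coe x =>
    rw [eexp_coe, ENNReal.le_ofReal_iff_toReal_le (by simp) (Real.exp_pos _).le,
      ENNReal.toReal_add (by simp) (by simp)]
    simpa [add_comm] using Real.add_one_le_exp (x : ℝ)

/-- From `|e ^ x - 1 - x| ≤ x ^ 2` and `x ^ 2 ≤ x` on `[0, 1]`. This linearisation is the source of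
every factor `2` in the exponential bounds below. -/
lemma eexp_le_one_add_two_mul {x : ℝ≥0∞} (hx : x ≤ 1) : eexp x ≤ 1 + 2 * x := by
  lift x to ℝ≥0 using (hx.trans_lt ENNReal.one_lt_top).ne
  have hx1 : (x : ℝ) ≤ 1 := by exact_mod_cast hx
  rw [eexp_coe]
  apply ENNReal.ofReal_le_of_le_toReal
  rw [ENNReal.toReal_add (by simp) (ENNReal.mul_ne_top (by simp) (by simp))]
  have h := (abs_le.1 (Real.abs_exp_sub_one_sub_id_le (x := x) (by simpa using hx1))).2
  have h0 : (0 : ℝ) ≤ x := x.2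
  simp only [ENNReal.toReal_one, ENNReal.toReal_mul, ENNReal.toReal_ofNat, ENNReal.coe_toReal]
  nlinarith

lemma pow_le_factorial_mul_eexp (x : ℝ≥0∞) (m : ℕ) : x ^ m ≤ m.factorial * eexp x := by
  induction x with
  | top => simp [ENNReal.mul_top, Nat.factorial_ne_zero]
  | coe x =>
    rw [eexp_coe, ← ENNReal.ofReal_natCast, ← ENNReal.ofReal_mul (by positivity),
      ← ENNReal.ofReal_coe_nnreal, ← ENNReal.ofReal_pow (NNReal.coe_nonneg x)]
    apply ENNReal.ofReal_le_ofReal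
    have h := Real.pow_div_factorial_le_exp (x : ℝ) x.2 m
    rwa [div_le_iff₀' (by positivity)] at h

lemma continuous_eexp : Continuous eexp :=
  _root_.ENNReal.continuous_exp.comp continuous_coe_ennreal_ereal

lemma eexp_iSup {ι : Type*} [Nonempty ι] (u : ι → ℝ≥0∞) : eexp (⨆ i, u i) = ⨆ i, eexp (u i) :=
  Monotone.map_ciSup_of_continuousAt continuous_eexp.continuousAt eexp_mono (OrderTop.bddAbove _)

/-! ### Poisson laws and exponential moments of Poisson processes -/

/-- Replacing `e ^ c` by `1 + 2c` leaves the Poisson generating function at `1 + 2c`, which equals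
`exp (2cm)`. -/
lemma lintegral_eexp_poissonLaw_le (m : ℝ≥0∞) {c : ℝ≥0∞} (hc : c ≤ 1) :
    ∫⁻ x, eexp (c * x) ∂(poissonLaw m) ≤ eexp (2 * (c * m)) := by
  by_cases hm : m = ∞
  · subst hm
    rcases eq_or_ne c 0 with rfl | hc0
    · simp [poissonLaw]
    · simp [ENNReal.mul_top hc0]
  lift m to ℝ≥0 using hm
  lift c to ℝ≥0 using (hc.trans_lt ENNReal.one_lt_top).ne
  have hpow : ∀ n : ℕ, eexp ((c : ℝ≥0∞) * (n : ℝ≥0∞)) ≤ ((1 + 2 * c : ℝ≥0) : ℝ≥0∞) ^ n := by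
    intro n
    have : (c : ℝ≥0∞) * n = ∑ _i : Fin n, (c : ℝ≥0∞) := by simp [mul_comm]
    rw [this, eexp_sum]
    simp only [Finset.prod_const, Finset.card_univ, Fintype.card_fin]
    exact pow_le_pow_left' (by simpa using eexp_le_one_add_two_mul hc) n
  have hlaw : poissonLaw (m : ℝ≥0∞) = (poissonMeasure m).map fun n : ℕ => (n : ℝ≥0∞) := by
    simp [poissonLaw]
  rw [hlaw, lintegral_map (by exact measurable_eexp.comp (measurable_const_mul _))
    (measurable_from_nat)]
  calc ∫⁻ n : ℕ, eexp ((c : ℝ≥0∞) * (n : ℝ≥0∞)) ∂(poissonMeasure m)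
      ≤ ∫⁻ n : ℕ, ((1 + 2 * c : ℝ≥0) : ℝ≥0∞) ^ n ∂(poissonMeasure m) := lintegral_mono hpow
    _ = ∑' n : ℕ, ENNReal.ofReal (Real.exp (-m) * ((m * (1 + 2 * c)) ^ n / n.factorial)) := by
        rw [lintegral_countable']
        refine tsum_congr fun n => ?_
        rw [poissonMeasure_singleton, ← ENNReal.ofReal_coe_nnreal,
          ← ENNReal.ofReal_pow (NNReal.coe_nonneg _), ← ENNReal.ofReal_mul (by positivity)]
        congr 1
        push_cast
        rw [mul_pow]
        ring
    _ = eexp (2 * ((c : ℝ≥0∞) * m)) := by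
        have hs := (NormedSpace.expSeries_div_hasSum_exp (𝔸 := ℝ) ((m : ℝ) * (1 + 2 * c))).mul_left
          (Real.exp (-m))
        rw [← ENNReal.ofReal_tsum_of_nonneg (fun n => by positivity) hs.summable, hs.tsum_eq,
          ← Real.exp_eq_exp_ℝ, ← Real.exp_add]
        have : (2 * ((c : ℝ≥0∞) * m)) = ((2 * (c * m) : ℝ≥0) : ℝ≥0∞) := by push_cast; rfl
        rw [this, eexp_coe]
        congr 2
        push_cast
        ring

/-- The probability is `1 - e ^ (-m) (1 + m)`, and `e ^ (-m) ≥ 1 - m`. The quadratic order is what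
makes the union bound over short time intervals vanish. -/
lemma poissonLaw_Ioi_one_le (m : ℝ≥0∞) : poissonLaw m (Set.Ioi 1) ≤ m ^ 2 := by
  by_cases hm : m = ∞
  · subst hm; simp
  lift m to ℝ≥0 using hm
  have hlaw : poissonLaw (m : ℝ≥0∞) = (poissonMeasure m).map fun n : ℕ => (n : ℝ≥0∞) := by
    simp [poissonLaw]
  have hset : (fun n : ℕ => (n : ℝ≥0∞)) ⁻¹' Set.Ioi 1 = (Finset.range 2 : Set ℕ)ᶜ := by
    ext n
    simp only [Set.mem_preimage, Set.mem_Ioi, Finset.coe_range, Set.mem_compl_iff, Set.mem_Iio]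
    rw [Nat.one_lt_cast]; omega
  rw [hlaw, Measure.map_apply measurable_from_nat measurableSet_Ioi, hset,
    prob_compl_eq_one_sub (Finset.measurableSet _), ← sum_measure_singleton]
  simp only [Finset.sum_range_succ, Finset.sum_range_zero, poissonMeasure_singleton, zero_add]
  rw [← ENNReal.ofReal_add (by positivity) (by positivity), ← ENNReal.ofReal_one,
    ← ENNReal.ofReal_sub _ (by positivity), ← ENNReal.ofReal_coe_nnreal,
    ← ENNReal.ofReal_pow (NNReal.coe_nonneg m)]
  apply ENNReal.ofReal_le_ofReal
  have h := Real.add_one_le_exp (-(m : ℝ))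
  have h0 : (0 : ℝ) ≤ m := m.2
  simp only [pow_zero, mul_one, Nat.factorial_zero, Nat.cast_one, div_one, pow_one,
    Nat.factorial_one]
  nlinarith

section Laplace

variable {d : ℕ} {𝔹 Ω : Type*} [MeasurableSpace 𝔹] [MeasurableSpace Ω]
  {Ψ : Ω → Measure (Space d × 𝔹)} {μ : Measure (Space d × 𝔹)} {P : Measure Ω}

/-- The level sets of `f` are disjoint, so their counts are independent and the expectation
factorises into one-dimensional Poisson bounds. -/
lemma IsPoissonProcess.lintegral_eexp_simple_le (hΨ : IsPoissonProcess Ψ μ P)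
    (f : SimpleFunc (Space d × 𝔹) ℝ≥0∞) (hf : ∀ x, f x ≤ 1) :
    ∫⁻ ω, eexp (f.lintegral (Ψ ω)) ∂P ≤ eexp (2 * f.lintegral μ) := by
  classical
  set e := f.range.equivFin
  have key : ∀ ν : Measure (Space d × 𝔹), f.lintegral ν =
      ∑ i, ((e.symm i : ℝ≥0∞)) * ν (f ⁻¹' {(e.symm i : ℝ≥0∞)}) := by
    intro ν
    rw [SimpleFunc.lintegral, ← Finset.sum_coe_sort f.range
      (fun x => x * ν (f ⁻¹' {x}))]
    exact (Equiv.sum_comp e.symm (fun x => (x : ℝ≥0∞) * ν (f ⁻¹' {(x : ℝ≥0∞)}))).symm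
  have hle : ∀ i, (e.symm i : ℝ≥0∞) ≤ 1 := by
    intro i
    obtain ⟨x, hx⟩ := SimpleFunc.mem_range.1 (e.symm i).2
    exact hx ▸ hf x
  have hmeas : ∀ i, MeasurableSet (f ⁻¹' {(e.symm i : ℝ≥0∞)}) := fun i =>
    f.measurableSet_preimage _
  have hind := hΨ.indep _ (fun i => f ⁻¹' {(e.symm i : ℝ≥0∞)}) hmeas (by
    intro i j hij
    refine Disjoint.preimage f (Set.disjoint_singleton.2 fun h => hij ?_)
    exact e.symm.injective (Subtype.ext h))
  have hev : ∀ i, Measurable fun ω => Ψ ω (f ⁻¹' {(e.symm i : ℝ≥0∞)}) := fun i =>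
    (Measure.measurable_coe (hmeas i)).comp hΨ.measurable
  have hg : ∀ i, Measurable fun x : ℝ≥0∞ => eexp ((e.symm i : ℝ≥0∞) * x) := fun i =>
    measurable_eexp.comp (measurable_const_mul _)
  simp_rw [key, eexp_sum]
  rw [Finset.mul_sum, eexp_sum,
    lintegral_prod_eq_prod_lintegral_of_indepFun Finset.univ
      (fun i ω => eexp ((e.symm i : ℝ≥0∞) * Ψ ω (f ⁻¹' {(e.symm i : ℝ≥0∞)})))
      (hind.comp _ hg) (fun i => (hg i).comp (hev i))]
  refine Finset.prod_le_prod' fun i _ => ?_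
  rw [← lintegral_map (hg i) (hev i), hΨ.law _ (hmeas i)]
  exact lintegral_eexp_poissonLaw_le _ (hle i)

/-- An exponential moment bound for integrals with respect to a Poisson process. -/
lemma IsPoissonProcess.lintegral_eexp_le (hΨ : IsPoissonProcess Ψ μ P)
    {f : Space d × 𝔹 → ℝ≥0∞} (hf : Measurable f) (hf1 : ∀ x, f x ≤ 1) :
    ∫⁻ ω, eexp (∫⁻ x, f x ∂(Ψ ω)) ∂P ≤ eexp (2 * ∫⁻ x, f x ∂μ) := by
  have hmono : ∀ ν : Measure (Space d × 𝔹),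
      Monotone fun n => (SimpleFunc.eapprox f n).lintegral ν := fun ν i j h =>
    SimpleFunc.lintegral_mono (SimpleFunc.monotone_eapprox f h) le_rfl
  -- Monotone convergence along simple functions increasing to `f`; continuity of `eexp` lets it
  -- commute with the supremum.
  simp_rw [lintegral_eq_iSup_eapprox_lintegral hf, eexp_iSup]
  rw [lintegral_iSup]
  · refine iSup_le fun n => (hΨ.lintegral_eexp_simple_le _ fun x => ?_).trans
      (eexp_mono (by gcongr; exact le_iSup (fun n => (SimpleFunc.eapprox f n).lintegral μ) n))
    refine le_trans ?_ (hf1 x)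
    rw [← SimpleFunc.iSup_eapprox_apply hf x]
    exact le_iSup (fun n => SimpleFunc.eapprox f n x) n
  · intro n
    refine measurable_eexp.comp ?_
    simp_rw [← SimpleFunc.lintegral_eq_lintegral]
    exact (Measure.measurable_lintegral (SimpleFunc.measurable _)).comp hΨ.measurable
  · exact fun i j h ω => eexp_mono (hmono _ h)

end Laplace

/-! ### Counting measures -/

section Counting

variable {X : Type*} [MeasurableSpace X] {η : Measure X}

/-- Counting indices instead of atoms keeps track of multiplicities. -/
lemma IsCountingMeasure.exists_eq_encard (h : IsCountingMeasure η) :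
    ∃ (ι : Type) (x : ι → X), ∀ S, MeasurableSet S → η S = ((x ⁻¹' S).encard : ℝ≥0∞) := by
  obtain ⟨ι, -, x, rfl⟩ := h
  refine ⟨ι, x, fun S hS => ?_⟩
  rw [Measure.sum_apply _ hS, ← ENNReal.tsum_set_one, tsum_subtype (x ⁻¹' S) (fun _ => (1 : ℝ≥0∞))]
  refine tsum_congr fun i => ?_
  rw [Measure.dirac_apply' _ hS]
  by_cases h : x i ∈ S <;> simp [Set.indicator, h]

lemma IsCountingMeasure.restrict (h : IsCountingMeasure η) {S : Set X} (hS : MeasurableSet S) :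
    IsCountingMeasure (η.restrict S) := by
  classical
  obtain ⟨ι, _, x, rfl⟩ := h
  refine ⟨{i // x i ∈ S}, inferInstance, fun i => x i, ?_⟩
  ext T hT
  rw [Measure.restrict_apply hT, Measure.sum_apply _ (hT.inter hS), Measure.sum_apply _ hT]
  refine Eq.trans ?_ (tsum_subtype (x ⁻¹' S) (fun i => Measure.dirac (x i) T)).symm
  refine tsum_congr fun i => ?_
  by_cases h1 : x i ∈ T <;> by_cases h2 : x i ∈ S <;>
    simp [Set.indicator, Measure.dirac_apply' _ (hT.inter hS), Measure.dirac_apply' _ hT, h1, h2]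

lemma IsCountingMeasure.exists_eq_dirac (h : IsCountingMeasure η) (h1 : η Set.univ = 1) :
    ∃ y, η = Measure.dirac y := by
  obtain ⟨ι, x, hx⟩ := h.exists_eq_encard
  rw [hx _ MeasurableSet.univ, Set.preimage_univ] at h1
  have h2 : (Set.univ : Set ι).encard = 1 := by exact_mod_cast h1
  obtain ⟨i, hi⟩ := Set.encard_eq_one.1 h2
  refine ⟨x i, ?_⟩
  ext S hS
  rw [hx S hS, Measure.dirac_apply' _ hS]
  by_cases hiS : x i ∈ S
  · have : x ⁻¹' S = {i} := Set.Subset.antisymm (hi ▸ Set.subset_univ _) (by simpa using hiS)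
    simp [this, hiS]
  · have : x ⁻¹' S = ∅ := by
      refine Set.eq_empty_of_forall_notMem fun j hj => hiS ?_
      have : j ∈ ({i} : Set ι) := hi ▸ Set.mem_univ j
      rwa [Set.mem_singleton_iff.1 this] at hj
    simp [this, hiS]

variable [MeasurableSingletonClass X]

/-- Without multiple atoms in `S` the indexing map is injective there. This links the mass, which
depends measurably on the configuration, to the cardinality used in `coords`. -/
lemma IsCountingMeasure.measure_eq_ncard (h : IsCountingMeasure η) {S : Set X}
    (hS : MeasurableSet S) (hfin : η S ≠ ∞) (hsimple : ∀ z ∈ S, η {z} ≤ 1) :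
    (points η ∩ S).Finite ∧ η S = ((points η ∩ S).ncard : ℝ≥0∞) := by
  obtain ⟨ι, x, hx⟩ := h.exists_eq_encard
  have himg : x '' (x ⁻¹' S) = points η ∩ S := by
    rw [Set.image_preimage_eq_range_inter]
    congr 1
    ext z
    simp only [points, Set.mem_ofPred_eq, hx _ (measurableSet_singleton z), Set.mem_range]
    simp [Set.encard_eq_zero, Set.eq_empty_iff_forall_notMem]
  have hinj : Set.InjOn x (x ⁻¹' S) := by
    intro i hi j _ hij
    have h1 := hsimple _ hi
    rw [hx _ (measurableSet_singleton _)] at h1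
    have h2 : (x ⁻¹' {x i}).encard ≤ 1 := by exact_mod_cast h1
    exact Set.encard_le_one_iff.1 h2 i j rfl hij.symm
  have hS' := hx S hS
  rw [← hinj.encard_image, himg] at hS'
  have hfin' : (points η ∩ S).Finite := by
    rw [← Set.encard_ne_top_iff]
    intro htop
    rw [htop] at hS'
    exact hfin (by simpa using hS')
  refine ⟨hfin', ?_⟩
  rw [hS', ← hfin'.cast_ncard_eq]
  simp

lemma IsCountingMeasure.finite_points (h : IsCountingMeasure η) {S : Set X}
    (hS : MeasurableSet S) (hfin : η S ≠ ∞) : (points η ∩ S).Finite := by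
  obtain ⟨ι, x, hx⟩ := h.exists_eq_encard
  have himg : points η ∩ S ⊆ x '' (x ⁻¹' S) := by
    rw [Set.image_preimage_eq_range_inter]
    refine Set.inter_subset_inter_left _ fun z hz => ?_
    simp only [points, Set.mem_ofPred_eq, hx _ (measurableSet_singleton z)] at hz
    by_contra hne
    refine hz ?_
    rw [Set.eq_empty_of_forall_notMem (s := x ⁻¹' {z}) fun i hi => hne ⟨i, hi⟩]
    simp
  refine Set.Finite.subset (Set.Finite.image _ ?_) himg
  rw [← Set.encard_ne_top_iff]
  intro htop
  rw [hx S hS, htop] at hfin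
  simp at hfin

lemma IsCountingMeasure.subsingleton_points (h : IsCountingMeasure η) {S : Set X}
    (hS : MeasurableSet S) (h1 : η S ≤ 1) {q q' : X} (hq : q ∈ points η ∩ S)
    (hq' : q' ∈ points η ∩ S) : q = q' := by
  have := h.measure_eq_ncard hS (h1.trans_lt ENNReal.one_lt_top).ne
    fun z hz => (measure_mono (Set.singleton_subset_iff.2 hz)).trans h1
  rw [this.2] at h1
  exact (Set.ncard_le_one this.1).1 (by exact_mod_cast h1) _ hq _ hq'

end Counting

/-! ### Unit cubes -/

section Cubes

variable {d : ℕ}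

lemma measurable_cubeIndex (enum : ℕ ≃ (Fin d → ℤ)) : Measurable (cubeIndex enum) := by
  refine (measurable_of_countable enum.symm).comp (measurable_pi_lambda _ fun i => ?_)
  exact Int.measurable_floor.comp (by fun_prop)

lemma isBounded_box (a b : Fin d → ℝ) :
    Bornology.IsBounded {x : Space d | ∀ i, a i ≤ x i ∧ x i ≤ b i} := by
  refine ((PiLp.antilipschitzWith_ofLp 2 fun _ : Fin d => ℝ).isBounded_preimage
    (Metric.isBounded_Icc a b)).subset fun x hx => ?_
  exact ⟨fun i => (hx i).1, fun i => (hx i).2⟩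

lemma isBounded_cubeIndex_eq (enum : ℕ ≃ (Fin d → ℤ)) (k : ℕ) :
    Bornology.IsBounded {x : Space d | cubeIndex enum x = k} := by
  refine (isBounded_box (fun i => (enum k i : ℝ)) (fun i => (enum k i : ℝ) + 1)).subset ?_
  intro x hx i
  have h : (fun i => ⌊x i⌋) = enum k := (Equiv.symm_apply_eq _).1 hx
  have hi : ⌊x i⌋ = enum k i := congrFun h i
  rw [← hi]
  exact ⟨Int.floor_le _, (Int.lt_floor_add_one _).le⟩

lemma IsCube.isBounded {W : Set (Space d)} (h : IsCube W) : Bornology.IsBounded W := by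
  obtain ⟨c, r, -, rfl⟩ := h
  exact (isBounded_box (fun i => c i) (fun i => c i + r)).subset
    fun x hx i => ⟨(hx i).1, (hx i).2.le⟩

lemma IsCube.measurableSet {W : Set (Space d)} (h : IsCube W) : MeasurableSet W := by
  obtain ⟨c, r, -, rfl⟩ := h
  rw [Set.ofPred_forall]
  refine MeasurableSet.iInter fun i => ?_
  have hi : Measurable fun x : Space d => x i := by fun_prop
  exact (measurableSet_le measurable_const hi).inter (measurableSet_lt hi measurable_const)

end Cubes

/-! ### Configurations and their points as functions of the coordinates -/

section Config

variable {d α : ℕ} {𝔸 : Type*} [MeasurableSpace 𝔸]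

/-- Locally finite counting measures on `ℝ^d × 𝔸 × [0,1] × 𝕄`. -/
abbrev Config (d : ℕ) (𝔸 : Type*) [MeasurableSpace 𝔸] (α : ℕ) : Type _ :=
  {ψ : Measure (Pt d 𝔸 α) // IsCountingMeasure ψ ∧ IsLocFinite ψ}

lemma measurable_time : Measurable (Pt.time : Pt d 𝔸 α → unitInterval) :=
  measurable_fst.comp (measurable_snd.comp measurable_snd)

lemma measurable_vertex : Measurable (Pt.vertex : Pt d 𝔸 α → Space d × 𝔸) :=
  measurable_fst.prodMk (measurable_fst.comp measurable_snd)

lemma measurable_decor : Measurable (Pt.decor : Pt d 𝔸 α → Decor α) :=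
  measurable_snd.comp (measurable_snd.comp measurable_snd)

/-- The evaluation kernel on configurations. -/
def configKernel (d : ℕ) (𝔸 : Type*) [MeasurableSpace 𝔸] (α : ℕ) :
    Kernel (Config d 𝔸 α) (Pt d 𝔸 α) :=
  ⟨Subtype.val, measurable_subtype_coe⟩

/-- The set of points over the cube with index `k`. -/
def column (enum : ℕ ≃ (Fin d → ℤ)) (k : ℕ) : Set (Pt d 𝔸 α) := {z | cubeIndex enum z.1 = k}

lemma measurableSet_column (enum : ℕ ≃ (Fin d → ℤ)) (k : ℕ) :
    MeasurableSet (column enum k : Set (Pt d 𝔸 α)) :=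
  ((measurable_cubeIndex enum).comp measurable_fst) (measurableSet_singleton k)

lemma IsLocFinite.column_lt_top {ψ : Measure (Pt d 𝔸 α)} (h : IsLocFinite ψ)
    (enum : ℕ ≃ (Fin d → ℤ)) (k : ℕ) : ψ (column enum k) < ∞ := by
  have := h {x | cubeIndex enum x = k}
    (measurable_cubeIndex enum (measurableSet_singleton k)) (isBounded_cubeIndex_eq enum k)
  refine (measure_mono ?_).trans_lt this
  exact fun z hz => ⟨hz, trivial⟩

/-- S-finiteness is needed for the measurability of masses of sets that themselves vary with the
configuration. -/
lemma isSFiniteKernel_configKernel (enum : ℕ ≃ (Fin d → ℤ)) :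
    IsSFiniteKernel (configKernel d 𝔸 α) := by
  classical
  have hmeas : ∀ k, Measurable fun ψ : Config d 𝔸 α => ψ.1 (column enum k) := fun k =>
    (Measure.measurable_coe (measurableSet_column enum k)).comp measurable_subtype_coe
  have hset : ∀ p : ℕ × ℕ,
      MeasurableSet {ψ : Config d 𝔸 α | ⌊(ψ.1 (column enum p.1)).toNNReal⌋₊ = p.2} := fun p =>
    (Nat.measurable_floor.comp (hmeas p.1).ennreal_toNNReal) (measurableSet_singleton p.2)
  -- Local finiteness gives no bound uniform in the configuration, so the mass over each cube is
  -- also split by its integer part: the piece `(k, n)` has mass at most `n + 1`.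
  let κ : ℕ × ℕ → Kernel (Config d 𝔸 α) (Pt d 𝔸 α) := fun p =>
    Kernel.piecewise (hset p) ((configKernel d 𝔸 α).restrict (measurableSet_column enum p.1)) 0
  have hfin : ∀ p, IsFiniteKernel (κ p) := by
    intro p
    refine ⟨⟨(p.2 + 1 : ℕ), by simp, fun ψ => ?_⟩⟩
    simp only [κ, Kernel.piecewise_apply]
    split_ifs with h
    · rw [Kernel.restrict_apply, Measure.restrict_apply_univ]
      have h1 := (Nat.lt_floor_add_one (ψ.1 (column enum p.1)).toNNReal).le
      have h2 : ⌊(ψ.1 (column enum p.1)).toNNReal⌋₊ = p.2 := h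
      rw [h2] at h1
      change ψ.1 (column enum p.1) ≤ _
      rw [← ENNReal.coe_toNNReal (ψ.2.2.column_lt_top enum p.1).ne]
      exact_mod_cast h1
    · simp
  have hsum : configKernel d 𝔸 α = Kernel.sum κ := by
    ext ψ S hS
    rw [Kernel.sum_apply' _ _ hS, ENNReal.tsum_prod (f := fun k n => κ (k, n) ψ S)]
    have h1 : ∀ k, ∑' n, κ (k, n) ψ S = ψ.1 (S ∩ column enum k) := by
      intro k
      rw [tsum_eq_single ⌊(ψ.1 (column enum k)).toNNReal⌋₊]
      · simp only [κ, Kernel.piecewise_apply]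
        rw [if_pos (by simp), Kernel.restrict_apply' _ _ _ hS]
        rfl
      · intro n hn
        simp only [κ, Kernel.piecewise_apply]
        rw [if_neg (by simpa using hn.symm)]
        simp
    simp_rw [h1]
    rw [← measure_iUnion _ fun k => hS.inter (measurableSet_column enum k), ← Set.inter_iUnion]
    · have : (⋃ k, column enum k : Set (Pt d 𝔸 α)) = Set.univ :=
        Set.eq_univ_of_forall fun z => Set.mem_iUnion.2 ⟨cubeIndex enum z.1, rfl⟩
      rw [this, Set.inter_univ]
      rfl
    · intro k l hkl
      refine Set.disjoint_left.2 fun z hz hz' => hkl ?_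
      exact hz.2.symm.trans hz'.2
  rw [hsum]
  infer_instance

/-- The mass of the points over the cube with index `k` whose time is at most `t`. -/
def rank (enum : ℕ ≃ (Fin d → ℤ)) (ψ : Measure (Pt d 𝔸 α)) (k : ℕ) (t : unitInterval) : ℝ≥0∞ :=
  ψ (column enum k ∩ {z | Pt.time z ≤ t})

/-- The points over the cube with index `κ.1` at whose time the rank is `κ.2`. -/
def slot (enum : ℕ ≃ (Fin d → ℤ)) (ψ : Measure (Pt d 𝔸 α)) (κ : ℕ × ℕ) : Set (Pt d 𝔸 α) :=
  {q | cubeIndex enum q.1 = κ.1 ∧ rank enum ψ κ.1 (Pt.time q) = κ.2}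

lemma measurable_rank (enum : ℕ ≃ (Fin d → ℤ)) (k : ℕ) :
    Measurable fun p : Config d 𝔸 α × unitInterval => rank enum p.1.1 k p.2 := by
  have := isSFiniteKernel_configKernel (𝔸 := 𝔸) (α := α) enum
  have ht : MeasurableSet {p : (Config d 𝔸 α × unitInterval) × Pt d 𝔸 α |
      p.2 ∈ column enum k ∧ Pt.time p.2 ≤ p.1.2} :=
    ((measurable_snd) (measurableSet_column enum k)).inter
      (measurableSet_le (f := fun p : (Config d 𝔸 α × unitInterval) × Pt d 𝔸 α => Pt.time p.2)
      (measurable_time.comp measurable_snd) (measurable_snd.comp measurable_fst))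
  exact Kernel.measurable_kernel_prodMk_left
    (κ := (configKernel d 𝔸 α).prodMkRight unitInterval) ht

lemma measurableSet_slot_graph (enum : ℕ ≃ (Fin d → ℤ)) (κ : ℕ × ℕ) :
    MeasurableSet {p : Config d 𝔸 α × Pt d 𝔸 α | p.2 ∈ slot enum p.1.1 κ} := by
  refine MeasurableSet.inter (measurable_snd (measurableSet_column enum κ.1)) ?_
  exact ((measurable_rank enum κ.1).comp
    (measurable_fst.prodMk (measurable_time.comp measurable_snd))) (measurableSet_singleton _)

lemma measurableSet_slot (enum : ℕ ≃ (Fin d → ℤ)) (ψ : Config d 𝔸 α) (κ : ℕ × ℕ) :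
    MeasurableSet (slot enum ψ.1 κ) :=
  measurable_prodMk_left (x := ψ) (measurableSet_slot_graph enum κ)

lemma measurable_measure_slot_inter (enum : ℕ ≃ (Fin d → ℤ)) (κ : ℕ × ℕ) {B : Set (Pt d 𝔸 α)}
    (hB : MeasurableSet B) :
    Measurable fun ψ : Config d 𝔸 α => ψ.1 (slot enum ψ.1 κ ∩ B) := by
  have := isSFiniteKernel_configKernel (𝔸 := 𝔸) (α := α) enum
  exact Kernel.measurable_kernel_prodMk_left (κ := configKernel d 𝔸 α)
    ((measurableSet_slot_graph enum κ).inter (measurable_snd hB))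

/-- There is exactly one point with coordinates `κ`. -/
def IsPresent (enum : ℕ ≃ (Fin d → ℤ)) (ψ : Measure (Pt d 𝔸 α)) (κ : ℕ × ℕ) : Prop :=
  ψ (slot enum ψ κ) = 1

lemma measurableSet_isPresent (enum : ℕ ≃ (Fin d → ℤ)) (κ : ℕ × ℕ) :
    MeasurableSet {ψ : Config d 𝔸 α | IsPresent enum ψ.1 κ} := by
  have := measurable_measure_slot_inter (𝔸 := 𝔸) (α := α) enum κ MeasurableSet.univ
  simp only [Set.inter_univ] at this
  exact this (measurableSet_singleton 1)

/-- Over each unit cube there is at most one point (with multiplicity) at every time. -/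
def HasDistinctTimes (enum : ℕ ≃ (Fin d → ℤ)) (ψ : Measure (Pt d 𝔸 α)) : Prop :=
  ∀ k t, ψ (column enum k ∩ {z | Pt.time z = t}) ≤ 1

variable [Nonempty 𝔸]

open Classical in
/-- The point with coordinates `κ`. -/
def pointAt (enum : ℕ ≃ (Fin d → ℤ)) (ψ : Measure (Pt d 𝔸 α)) (κ : ℕ × ℕ) : Pt d 𝔸 α :=
  if IsPresent enum ψ κ then
    Classical.epsilon fun y => ψ.restrict (slot enum ψ κ) = Measure.dirac y
  else Classical.arbitrary _

lemma restrict_slot_eq_dirac {enum : ℕ ≃ (Fin d → ℤ)} {ψ : Config d 𝔸 α} {κ : ℕ × ℕ}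
    (h : IsPresent enum ψ.1 κ) :
    ψ.1.restrict (slot enum ψ.1 κ) = Measure.dirac (pointAt enum ψ.1 κ) := by
  rw [pointAt, if_pos h]
  refine Classical.epsilon_spec (p := fun y => ψ.1.restrict (slot enum ψ.1 κ) = Measure.dirac y) ?_
  refine (ψ.2.1.restrict (measurableSet_slot enum ψ κ)).exists_eq_dirac ?_
  rwa [Measure.restrict_apply_univ]

/-- The points of a configuration as a function of the coordinates. -/
def record (enum : ℕ ≃ (Fin d → ℤ)) (ψ : Config d 𝔸 α) (κ : ℕ × ℕ) : Pt d 𝔸 α × Prop :=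
  (pointAt enum ψ.1 κ, IsPresent enum ψ.1 κ)

/-- The point is obtained by choice, but whether it lies in `B` is read off from the mass of `B`
inside the slot. -/
lemma measurable_pointAt (enum : ℕ ≃ (Fin d → ℤ)) (κ : ℕ × ℕ) :
    Measurable fun ψ : Config d 𝔸 α => pointAt enum ψ.1 κ := by
  intro B hB
  have hset : (fun ψ : Config d 𝔸 α => pointAt enum ψ.1 κ) ⁻¹' B =
      ({ψ | IsPresent enum ψ.1 κ} ∩ {ψ | ψ.1 (slot enum ψ.1 κ ∩ B) = 1}) ∪
      ({ψ | IsPresent enum ψ.1 κ}ᶜ ∩ {_ψ | Classical.arbitrary (Pt d 𝔸 α) ∈ B}) := by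
    ext ψ
    by_cases h : IsPresent enum ψ.1 κ
    · have h1 : ψ.1 (slot enum ψ.1 κ ∩ B) = Measure.dirac (pointAt enum ψ.1 κ) B := by
        rw [← restrict_slot_eq_dirac h, Measure.restrict_apply hB, Set.inter_comm]
      rw [Measure.dirac_apply' _ hB] at h1
      by_cases hm : pointAt enum ψ.1 κ ∈ B <;> simp [h, h1, hm]
    · have : pointAt enum ψ.1 κ = Classical.arbitrary _ := if_neg h
      simp [h, this]
  rw [hset]
  exact ((measurableSet_isPresent enum κ).inter
    ((measurable_measure_slot_inter enum κ hB) (measurableSet_singleton 1))).union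
    ((measurableSet_isPresent enum κ).compl.inter (MeasurableSet.const _))

lemma measurable_record (enum : ℕ ≃ (Fin d → ℤ)) :
    Measurable (record enum : Config d 𝔸 α → ℕ × ℕ → Pt d 𝔸 α × Prop) :=
  measurable_pi_lambda _ fun κ => (measurable_pointAt enum κ).prodMk
    (measurableSet_setOfPred.1 (measurableSet_isPresent enum κ))

-- Slots with different coordinates are disjoint and a present slot carries a single Dirac mass, so
-- the sum is dominated by an integral over a disjoint union.
open Classical in
lemma sum_pointAt_le_lintegral (enum : ℕ ≃ (Fin d → ℤ)) (ψ : Config d 𝔸 α)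
    {f : Pt d 𝔸 α → ℝ≥0∞} (hf : Measurable f) (F : Finset (ℕ × ℕ)) :
    (∑ κ ∈ F, if IsPresent enum ψ.1 κ then f (pointAt enum ψ.1 κ) else 0) ≤ ∫⁻ x, f x ∂ψ.1 := by
  calc (∑ κ ∈ F, if IsPresent enum ψ.1 κ then f (pointAt enum ψ.1 κ) else 0)
      ≤ ∑ κ ∈ F, ∫⁻ x in slot enum ψ.1 κ, f x ∂ψ.1 := by
        refine Finset.sum_le_sum fun κ _ => ?_
        split_ifs with h
        · rw [restrict_slot_eq_dirac h, lintegral_dirac' _ hf]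
        · exact zero_le
    _ = ∫⁻ x in ⋃ κ ∈ F, slot enum ψ.1 κ, f x ∂ψ.1 := by
        rw [lintegral_biUnion_finset _ fun κ _ => measurableSet_slot enum ψ κ]
        intro κ _ κ' _ hne
        refine Set.disjoint_left.2 fun z hz hz' => hne ?_
        have h1 : κ.1 = κ'.1 := hz.1.symm.trans hz'.1
        refine Prod.ext h1 ?_
        have h2 := hz.2.symm.trans (h1 ▸ hz'.2)
        exact_mod_cast h2
    _ ≤ ∫⁻ x, f x ∂ψ.1 := setLIntegral_le_lintegral _ _

end Config

/-! ### Configurations with distinct times: coordinates determine points. -/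

section Distinct

variable {d α : ℕ} {𝔸 : Type*} [MeasurableSpace 𝔸]

lemma measurableSet_column_inter_time (enum : ℕ ≃ (Fin d → ℤ)) (k : ℕ) {I : Set unitInterval}
    (hI : MeasurableSet I) :
    MeasurableSet (column enum k ∩ Pt.time ⁻¹' I : Set (Pt d 𝔸 α)) :=
  (measurableSet_column enum k).inter (measurable_time hI)

variable {enum : ℕ ≃ (Fin d → ℤ)} {ψ : Config d 𝔸 α}

lemma HasDistinctTimes.measure_singleton_le (h : HasDistinctTimes enum ψ.1) (q : Pt d 𝔸 α) :
    ψ.1 {q} ≤ 1 := by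
  refine (measure_mono ?_).trans (h (cubeIndex enum q.1) (Pt.time q))
  rintro _ rfl
  exact ⟨rfl, rfl⟩

variable [StandardBorelSpace 𝔸]

lemma HasDistinctTimes.eq_of_time_eq (h : HasDistinctTimes enum ψ.1) {q q' : Pt d 𝔸 α}
    (hq : q ∈ points ψ.1) (hq' : q' ∈ points ψ.1) (hc : cubeIndex enum q.1 = cubeIndex enum q'.1)
    (ht : Pt.time q = Pt.time q') : q = q' :=
  ψ.2.1.subsingleton_points
    (measurableSet_column_inter_time enum _ (measurableSet_singleton (Pt.time q)))
    (h (cubeIndex enum q.1) (Pt.time q)) ⟨hq, rfl, rfl⟩ ⟨hq', hc.symm, ht.symm⟩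

lemma HasDistinctTimes.rank_eq (h : HasDistinctTimes enum ψ.1) (q : Pt d 𝔸 α) :
    rank enum ψ.1 (cubeIndex enum q.1) (Pt.time q) = (coords enum ψ.1 q).2 := by
  have := (ψ.2.1.measure_eq_ncard
    (measurableSet_column_inter_time enum (cubeIndex enum q.1) (measurableSet_Iic (a := Pt.time q)))
    ((measure_mono Set.inter_subset_left).trans_lt
      (ψ.2.2.column_lt_top enum (cubeIndex enum q.1))).ne
    fun z _ => h.measure_singleton_le z).2
  exact this

lemma HasDistinctTimes.mem_slot_iff (h : HasDistinctTimes enum ψ.1) (q : Pt d 𝔸 α) (κ : ℕ × ℕ) :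
    q ∈ slot enum ψ.1 κ ↔ coords enum ψ.1 q = κ := by
  constructor
  · rintro ⟨h1, h2⟩
    refine Prod.ext h1 ?_
    rw [← h1, h.rank_eq] at h2
    exact_mod_cast h2
  · rintro rfl
    exact ⟨rfl, h.rank_eq q⟩

/-- For equal coordinates, the points up to the earlier time are contained in those up to the later
time and have the same finite cardinality. The two sets agree, hence so do the times. -/
lemma HasDistinctTimes.coords_injOn (h : HasDistinctTimes enum ψ.1) :
    Set.InjOn (coords enum ψ.1) (points ψ.1) := by
  have key : ∀ q ∈ points ψ.1, ∀ q' ∈ points ψ.1, coords enum ψ.1 q = coords enum ψ.1 q' →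
      Pt.time q ≤ Pt.time q' → q = q' := by
    intro q hq q' hq' hc ht
    have hcube : cubeIndex enum q.1 = cubeIndex enum q'.1 := congrArg Prod.fst hc
    have hfin : ∀ y : Pt d 𝔸 α, {z ∈ points ψ.1 | cubeIndex enum z.1 = cubeIndex enum y.1 ∧
        Pt.time z ≤ Pt.time y}.Finite := fun y =>
      (ψ.2.1.finite_points (measurableSet_column enum (cubeIndex enum y.1))
        (ψ.2.2.column_lt_top enum _).ne).subset fun z hz => ⟨hz.1, hz.2.1⟩
    have hsub : {z ∈ points ψ.1 | cubeIndex enum z.1 = cubeIndex enum q.1 ∧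
        Pt.time z ≤ Pt.time q} ⊆ {z ∈ points ψ.1 | cubeIndex enum z.1 = cubeIndex enum q'.1 ∧
        Pt.time z ≤ Pt.time q'} := fun z hz => ⟨hz.1, hz.2.1.trans hcube, hz.2.2.trans ht⟩
    have heq := Set.eq_of_subset_of_ncard_le hsub (congrArg Prod.snd hc).ge (hfin q')
    have hmem : q' ∈ {z ∈ points ψ.1 | cubeIndex enum z.1 = cubeIndex enum q.1 ∧
        Pt.time z ≤ Pt.time q} := by
      rw [heq]
      exact ⟨hq', rfl, le_rfl⟩
    exact h.eq_of_time_eq hq hq' hcube (le_antisymm ht hmem.2.2)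
  intro q hq q' hq' hc
  rcases le_total (Pt.time q) (Pt.time q') with ht | ht
  · exact key q hq q' hq' hc ht
  · exact (key q' hq' q hq hc.symm ht).symm

variable [Nonempty 𝔸]

lemma pointAt_mem {κ : ℕ × ℕ} (hκ : IsPresent enum ψ.1 κ) :
    pointAt enum ψ.1 κ ∈ points ψ.1 ∧ pointAt enum ψ.1 κ ∈ slot enum ψ.1 κ := by
  have h := restrict_slot_eq_dirac hκ
  set y := pointAt enum ψ.1 κ
  have h1 : y ∈ slot enum ψ.1 κ := by
    have h2 := congrArg (fun ν => ν (slot enum ψ.1 κ)) h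
    simp only [Measure.restrict_apply_self] at h2
    rw [hκ, Measure.dirac_apply' _ (measurableSet_slot enum ψ κ)] at h2
    by_contra hn
    simp [hn] at h2
  refine ⟨fun h0 => ?_, h1⟩
  have h2 := congrArg (fun ν => ν {y}) h
  simp only [Measure.dirac_apply' _ (measurableSet_singleton y)] at h2
  have h3 := Measure.restrict_apply_le (μ := ψ.1) (slot enum ψ.1 κ) {y}
  rw [h2, h0] at h3
  simp at h3

/-- Every atom appears in `record`; together with `coords_pointAt` this makes present labels and
atoms correspond bijectively. -/
lemma HasDistinctTimes.isPresent_coords (h : HasDistinctTimes enum ψ.1) {q : Pt d 𝔸 α}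
    (hq : q ∈ points ψ.1) :
    IsPresent enum ψ.1 (coords enum ψ.1 q) ∧ pointAt enum ψ.1 (coords enum ψ.1 q) = q := by
  have hp : IsPresent enum ψ.1 (coords enum ψ.1 q) := by
    have := (ψ.2.1.measure_eq_ncard (measurableSet_slot enum ψ (coords enum ψ.1 q))
      ((measure_mono fun z hz => hz.1).trans_lt (ψ.2.2.column_lt_top enum _)).ne
      fun z _ => h.measure_singleton_le z).2
    have hs : points ψ.1 ∩ slot enum ψ.1 (coords enum ψ.1 q) = {q} := by
      ext z
      constructor
      · rintro ⟨hz, hz'⟩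
        exact h.coords_injOn hz hq ((h.mem_slot_iff _ _).1 hz')
      · rintro rfl
        exact ⟨hq, (h.mem_slot_iff _ _).2 rfl⟩
    rw [IsPresent, this, hs]
    simp
  refine ⟨hp, ?_⟩
  have := pointAt_mem hp
  exact h.coords_injOn this.1 hq ((h.mem_slot_iff _ _).1 this.2)

lemma HasDistinctTimes.coords_pointAt (h : HasDistinctTimes enum ψ.1) {κ : ℕ × ℕ}
    (hκ : IsPresent enum ψ.1 κ) : coords enum ψ.1 (pointAt enum ψ.1 κ) = κ :=
  (h.mem_slot_iff _ _).1 (pointAt_mem hκ).2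

end Distinct

/-! ### Almost sure properties of the Poisson process. -/

section Almost

variable {d α : ℕ} {𝔸 : Type*} [MeasurableSpace 𝔸]
  {Ω : Type*} [MeasurableSpace Ω] {P : Measure Ω} {Ψ : Ω → Measure (Pt d 𝔸 α)}
  {γ : ℝ} {Θ : Measure 𝔸} [IsProbabilityMeasure Θ]

instance : IsProbabilityMeasure (decorLaw α) := by
  unfold decorLaw; infer_instance

lemma IsPoissonProcess.measure_one_lt_le {𝔹 : Type*} [MeasurableSpace 𝔹]
    {Ψ : Ω → Measure (Space d × 𝔹)} {μ : Measure (Space d × 𝔹)} (hΨ : IsPoissonProcess Ψ μ P)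
    {B : Set (Space d × 𝔹)} (hB : MeasurableSet B) : P {ω | 1 < Ψ ω B} ≤ μ B ^ 2 := by
  have hm : Measurable fun ω => Ψ ω B := (Measure.measurable_coe hB).comp hΨ.measurable
  have h := poissonLaw_Ioi_one_le (μ B)
  rw [← hΨ.law B hB, Measure.map_apply hm measurableSet_Ioi] at h
  exact h

lemma IsPoissonProcess.ae_eq_zero {𝔹 : Type*} [MeasurableSpace 𝔹]
    {Ψ : Ω → Measure (Space d × 𝔹)} {μ : Measure (Space d × 𝔹)} (hΨ : IsPoissonProcess Ψ μ P)
    {B : Set (Space d × 𝔹)} (hB : MeasurableSet B) (h0 : μ B = 0) : ∀ᵐ ω ∂P, Ψ ω B = 0 := by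
  have hm : Measurable fun ω => Ψ ω B := (Measure.measurable_coe hB).comp hΨ.measurable
  have h := hΨ.law B hB
  rw [h0] at h
  have hs : MeasurableSet {x : ℝ≥0∞ | x = 0} := measurableSet_singleton 0
  have h1 : ∀ᵐ x ∂(P.map fun ω => Ψ ω B), x = 0 := by
    rw [h, poissonLaw, if_neg ENNReal.zero_ne_top,
      ae_map_iff measurable_from_nat.aemeasurable hs, ae_iff]
    have : {n : ℕ | ¬ (n : ℝ≥0∞) = 0} = ({0} : Set ℕ)ᶜ := by ext; simp
    rw [this, prob_compl_eq_zero_iff (measurableSet_singleton 0), poissonMeasure_singleton]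
    simp
  exact (ae_map_iff hm.aemeasurable hs).1 h1

lemma intensity_column_time (enum : ℕ ≃ (Fin d → ℤ)) (k : ℕ) (I : Set unitInterval) :
    intensity d α γ Θ (column enum k ∩ Pt.time ⁻¹' I) =
      ENNReal.ofReal γ * volume {x : Space d | cubeIndex enum x = k} * volume I := by
  have : (column enum k ∩ Pt.time ⁻¹' I : Set (Pt d 𝔸 α)) =
      {x : Space d | cubeIndex enum x = k} ×ˢ (Set.univ ×ˢ (I ×ˢ Set.univ)) := by
    ext z
    simp [column, Pt.time]
  rw [this, intensity, Measure.prod_prod, Measure.prod_prod, Measure.prod_prod]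
  simp

lemma exists_mem_Icc_div (n : ℕ) (t : unitInterval) :
    ∃ j ∈ Finset.range (n + 1), (t : ℝ) ∈ Set.Icc ((j : ℝ) / (n + 1)) ((j + 1) / (n + 1)) := by
  have hn : (0 : ℝ) < n + 1 := by positivity
  rcases t.2.2.lt_or_eq with h | h
  · refine ⟨⌊(t : ℝ) * (n + 1)⌋₊, ?_, ?_, ?_⟩
    · rw [Finset.mem_range, Nat.floor_lt (mul_nonneg t.2.1 hn.le)]
      push_cast
      nlinarith
    · rw [div_le_iff₀ hn]
      exact Nat.floor_le (mul_nonneg t.2.1 hn.le)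
    · rw [le_div_iff₀ hn]
      exact (Nat.lt_floor_add_one _).le
  · refine ⟨n, by simp, ?_⟩
    rw [h]
    refine ⟨?_, ?_⟩
    · rw [div_le_one hn]; linarith
    · rw [div_self hn.ne']

lemma volume_unitInterval_Icc_le (a b : ℝ) :
    volume {t : unitInterval | (t : ℝ) ∈ Set.Icc a b} ≤ ENNReal.ofReal (b - a) := by
  rw [unitInterval.volume_apply, ← Real.volume_Icc]
  refine measure_mono ?_
  rintro _ ⟨t, ht, rfl⟩
  exact ht

/-- Cut `[0, 1]` into `n + 1` intervals. Two points with the same time share an interval, and the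
union bound is `(n + 1) (c / (n + 1)) ^ 2 → 0`, with `c` the intensity over the cube. -/
lemma IsPoissonProcess.ae_hasDistinctTimes (hΨ : IsPoissonProcess Ψ (intensity d α γ Θ) P)
    (enum : ℕ ≃ (Fin d → ℤ)) : ∀ᵐ ω ∂P, HasDistinctTimes enum (Ψ ω) := by
  unfold HasDistinctTimes
  rw [ae_all_iff]
  intro k
  set c : ℝ≥0∞ := ENNReal.ofReal γ * volume {x : Space d | cubeIndex enum x = k} with hc
  have hcfin : c ≠ ∞ :=
    ENNReal.mul_ne_top ENNReal.ofReal_ne_top (isBounded_cubeIndex_eq enum k).measure_lt_top.ne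
  have hbound : ∀ n : ℕ, P {ω | ¬ ∀ t, Ψ ω (column enum k ∩ {z | Pt.time z = t}) ≤ 1} ≤
      c ^ 2 * ((n : ℝ≥0∞) + 1)⁻¹ := by
    intro n
    let I : ℕ → Set unitInterval := fun j =>
      {t | (t : ℝ) ∈ Set.Icc ((j : ℝ) / (n + 1)) ((j + 1) / (n + 1))}
    have hI : ∀ j, MeasurableSet (I j) := fun j =>
      measurable_subtype_coe (measurableSet_Icc (α := ℝ))
    have hIle : ∀ j, volume (I j) ≤ ((n : ℝ≥0∞) + 1)⁻¹ := by
      intro j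
      refine (volume_unitInterval_Icc_le _ _).trans ?_
      have : ((j : ℝ) + 1) / (n + 1) - j / (n + 1) = ((n : ℝ) + 1)⁻¹ := by field_simp; ring
      rw [this, ENNReal.ofReal_inv_of_pos (by positivity),
        ENNReal.ofReal_add (by positivity) (by positivity)]
      simp
    calc P {ω | ¬ ∀ t, Ψ ω (column enum k ∩ {z | Pt.time z = t}) ≤ 1}
        ≤ P (⋃ j ∈ Finset.range (n + 1), {ω | 1 < Ψ ω (column enum k ∩ Pt.time ⁻¹' I j)}) := by
          refine measure_mono fun ω hω => ?_
          obtain ⟨t, ht⟩ := not_forall.1 (show ¬ ∀ t, _ from hω)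
          obtain ⟨j, hj, hjt⟩ := exists_mem_Icc_div n t
          refine Set.mem_iUnion₂.2 ⟨j, hj, ?_⟩
          refine (not_le.1 ht).trans_le (measure_mono ?_)
          rintro z ⟨hz, rfl⟩
          exact ⟨hz, hjt⟩
      _ ≤ ∑ j ∈ Finset.range (n + 1), P {ω | 1 < Ψ ω (column enum k ∩ Pt.time ⁻¹' I j)} :=
          measure_biUnion_finset_le _ _
      _ ≤ ∑ _j ∈ Finset.range (n + 1), (c * ((n : ℝ≥0∞) + 1)⁻¹) ^ 2 := by
          refine Finset.sum_le_sum fun j _ => ?_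
          refine (hΨ.measure_one_lt_le (measurableSet_column_inter_time enum k (hI j))).trans ?_
          rw [intensity_column_time enum k (I j)]
          gcongr
          exact hIle j
      _ = c ^ 2 * ((n : ℝ≥0∞) + 1)⁻¹ := by
          rw [Finset.sum_const, Finset.card_range, nsmul_eq_mul]
          push_cast
          have h1 : ((n : ℝ≥0∞) + 1) * ((n : ℝ≥0∞) + 1)⁻¹ = 1 :=
            ENNReal.mul_inv_cancel (by simp) (by simp)
          calc ((n : ℝ≥0∞) + 1) * (c * ((n : ℝ≥0∞) + 1)⁻¹) ^ 2
              = c ^ 2 * ((n : ℝ≥0∞) + 1)⁻¹ * (((n : ℝ≥0∞) + 1) * ((n : ℝ≥0∞) + 1)⁻¹) := by ring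
            _ = _ := by rw [h1, mul_one]
  rw [ae_iff, ← nonpos_iff_eq_zero]
  have hlim : Tendsto (fun n : ℕ => c ^ 2 * ((n : ℝ≥0∞) + 1)⁻¹) atTop (𝓝 (c ^ 2 * 0)) := by
    refine ENNReal.Tendsto.const_mul ?_ (Or.inr (by finiteness))
    have := (tendsto_add_atTop_iff_nat 1).2 ENNReal.tendsto_inv_nat_nhds_zero
    simpa using this
  rw [mul_zero] at hlim
  exact ge_of_tendsto' hlim hbound

/-- For `d ≥ 1` a single location is Lebesgue-null. At the origin this ensures that the added vertex
is the only one removed with `0`. -/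
lemma IsPoissonProcess.ae_fst_ne (hd : 1 ≤ d) (hΨ : IsPoissonProcess Ψ (intensity d α γ Θ) P)
    (x : Space d) : ∀ᵐ ω ∂P, ∀ z ∈ points (Ψ ω), z.1 ≠ x := by
  have : Nonempty (Fin d) := ⟨⟨0, hd⟩⟩
  have h0 : intensity (𝔸 := 𝔸) d α γ Θ ({x} ×ˢ Set.univ) = 0 := by
    rw [intensity, Measure.prod_prod]
    simp
  filter_upwards [hΨ.ae_eq_zero ((measurableSet_singleton x).prod MeasurableSet.univ) h0]
    with ω hω z hz hzx
  refine hz (measure_mono_null ?_ hω)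
  rintro _ rfl
  exact ⟨hzx, trivial⟩

end Almost

/-! ### The number of potential neighbours of the origin -/

section Degree

variable {d α : ℕ} {𝔸 : Type*}
  {φ : (j : ℕ) → (Fin (j + 1) → Space d × 𝔸) → unitInterval}

/-- The connection probability of the origin with mark `a` and the vertex `v`. -/
def originProb (φ : (j : ℕ) → (Fin (j + 1) → Space d × 𝔸) → unitInterval) (a : 𝔸)
    (v : Space d × 𝔸) : unitInterval := φ 1 ![(0, a), v]

/-- The index of the component of the decoration that decides about an edge to the point with
coordinates `κ`. -/
def edgeIndex (hα : 1 ≤ α) (κ : ℕ × ℕ) : Σ k : Fin α, (Fin ((k : ℕ) + 1) → ℕ × ℕ) :=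
  ⟨⟨0, hα⟩, fun _ => κ⟩

lemma edgeIndex_injective (hα : 1 ≤ α) : Function.Injective (edgeIndex hα) := by
  intro κ κ' h
  have := eq_of_heq (Sigma.mk.inj h).2
  exact congrFun this 0

open Classical in
/-- The number of neighbours of the origin with mark `a` and decoration `u`. -/
def degree (φ : (j : ℕ) → (Fin (j + 1) → Space d × 𝔸) → unitInterval) (hα : 1 ≤ α)
    (Y : ℕ × ℕ → Pt d 𝔸 α × Prop) (a : 𝔸) (u : Decor α) : ℝ≥0∞ :=
  ∑' κ, if (Y κ).2 ∧ u (edgeIndex hα κ) ≤ originProb φ a (Pt.vertex (Y κ).1) then 1 else 0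

lemma lintegral_eexp_indicator_le (p : unitInterval) {s : ℝ≥0∞} (hs : s ≤ 1) :
    ∫⁻ t : unitInterval, eexp (s * (Set.Iic p).indicator 1 t) ≤
      eexp (2 * (s * ENNReal.ofReal p)) := by
  calc ∫⁻ t : unitInterval, eexp (s * (Set.Iic p).indicator 1 t)
      ≤ ∫⁻ t : unitInterval, (1 + 2 * s * (Set.Iic p).indicator 1 t) := by
        refine lintegral_mono fun t => ?_
        by_cases ht : t ∈ Set.Iic p
        · simpa [ht] using eexp_le_one_add_two_mul hs
        · simp [ht]
    _ = 1 + 2 * s * ENNReal.ofReal p := by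
        rw [lintegral_add_left measurable_const, lintegral_const_mul _
          (measurable_one.indicator measurableSet_Iic), lintegral_indicator_one measurableSet_Iic,
          unitInterval.volume_Iic]
        simp
    _ ≤ _ := by
        rw [mul_assoc]
        exact one_add_le_eexp _

-- For a fixed configuration, different points use different components of the decoration, so the
-- edge indicators are independent. The bound is proved for finite partial sums, which increase to
-- the degree.
open Classical in
lemma lintegral_eexp_degree_le (hα : 1 ≤ α) (Y : ℕ × ℕ → Pt d 𝔸 α × Prop) (a : 𝔸)
    {s : ℝ≥0∞} (hs : s ≤ 1) :
    ∫⁻ u, eexp (s * degree φ hα Y a u) ∂(decorLaw α) ≤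
      eexp (2 * (s * ∑' κ, if (Y κ).2 then
        ENNReal.ofReal (originProb φ a (Pt.vertex (Y κ).1)) else 0)) := by
  have hterm : ∀ κ, Measurable fun t : unitInterval =>
      eexp (s * if (Y κ).2 ∧ t ≤ originProb φ a (Pt.vertex (Y κ).1) then 1 else 0) := fun κ =>
    measurable_eexp.comp (Measurable.const_mul (Measurable.ite
      ((MeasurableSet.const _).inter measurableSet_Iic) measurable_const measurable_const) s)
  have hind : iIndepFun (fun κ (u : Decor α) => eexp (s * if (Y κ).2 ∧ u (edgeIndex hα κ) ≤
      originProb φ a (Pt.vertex (Y κ).1) then 1 else 0)) (decorLaw α) :=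
    (((iIndepFun_infinitePi (P := fun _ : (Σ k : Fin α, (Fin ((k : ℕ) + 1) → ℕ × ℕ)) =>
      (volume : Measure unitInterval)) (X := fun _ => id) (fun _ => measurable_id)).precomp
      (edgeIndex_injective hα)).comp _ hterm)
  simp only [degree, ENNReal.tsum_eq_iSup_sum (f := fun κ => ite ((Y κ).2 ∧ _) _ _),
    ENNReal.mul_iSup, eexp_iSup]
  rw [lintegral_iSup_directed]
  · refine iSup_le fun F => ?_
    simp_rw [Finset.mul_sum, eexp_sum]
    rw [lintegral_prod_eq_prod_lintegral_of_indepFun F _ hind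
      fun κ => (hterm κ).comp (measurable_pi_apply _)]
    calc _ ≤ ∏ κ ∈ F, eexp (2 * (s * if (Y κ).2 then
          ENNReal.ofReal (originProb φ a (Pt.vertex (Y κ).1)) else 0)) := by
          refine Finset.prod_le_prod' fun κ _ => ?_
          rw [← lintegral_map (hterm κ) (measurable_pi_apply (edgeIndex hα κ)), decorLaw,
            Measure.infinitePi_map_eval]
          by_cases h : (Y κ).2
          · simp only [h, true_and, if_true]
            refine le_trans (le_of_eq ?_) (lintegral_eexp_indicator_le _ hs)
            rfl
          · simp [h]
      _ = eexp (2 * (s * ∑ κ ∈ F, if (Y κ).2 then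
          ENNReal.ofReal (originProb φ a (Pt.vertex (Y κ).1)) else 0)) := by
          rw [Finset.mul_sum, Finset.mul_sum, eexp_sum]
      _ ≤ _ := by
          apply eexp_mono
          gcongr
          exact ENNReal.sum_le_tsum F
  · intro F
    refine (measurable_eexp.comp (Measurable.const_mul (Finset.measurable_sum F fun κ _ => ?_)
      s)).aemeasurable
    refine Measurable.ite ((MeasurableSet.const _).inter ?_) measurable_const measurable_const
    exact measurable_pi_apply (edgeIndex hα κ) measurableSet_Iic
  · refine Monotone.directed_le fun F G hFG u => eexp_mono ?_
    gcongr

variable [MeasurableSpace 𝔸]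

lemma measurable_originProb (hφ : IsConnectionFamily α φ) (hα : 1 ≤ α) :
    Measurable fun p : 𝔸 × (Space d × 𝔸) => originProb φ p.1 p.2 := by
  refine (hφ.measurable 1 le_rfl hα).comp (measurable_pi_lambda _ fun i => ?_)
  fin_cases i
  · exact measurable_const.prodMk measurable_fst
  · exact measurable_snd

lemma measurable_degree (hφ : IsConnectionFamily α φ) (hα : 1 ≤ α) :
    Measurable fun p : (ℕ × ℕ → Pt d 𝔸 α × Prop) × 𝔸 × Decor α =>
      degree φ hα p.1 p.2.1 p.2.2 := by
  classical
  refine Measurable.tsum fun κ => Measurable.ite ?_ measurable_const measurable_const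
  have hY : Measurable fun p : (ℕ × ℕ → Pt d 𝔸 α × Prop) × 𝔸 × Decor α => p.1 κ :=
    (measurable_pi_apply κ).comp measurable_fst
  refine MeasurableSet.inter (measurableSet_setOfPred.2 (measurable_snd.comp hY)) ?_
  exact measurableSet_le
    (f := fun p : (ℕ × ℕ → Pt d 𝔸 α × Prop) × 𝔸 × Decor α => p.2.2 (edgeIndex hα κ))
    ((measurable_pi_apply _).comp (measurable_snd.comp measurable_snd))
    ((measurable_originProb hφ hα).comp ((measurable_fst.comp measurable_snd).prodMk
      (measurable_vertex.comp (measurable_fst.comp hY))))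

/-- The mean degree under the intensity measure is the mixing parameter, since the time and
decoration factors are probability measures. -/
lemma lintegral_originProb (γ : ℝ) (Θ : Measure 𝔸) [IsProbabilityMeasure Θ]
    (hφ : IsConnectionFamily α φ) (hα : 1 ≤ α) (a : 𝔸) :
    ∫⁻ q, ENNReal.ofReal (originProb φ a (Pt.vertex q)) ∂(intensity d α γ Θ) =
      mixingParam γ Θ φ a := by
  have hm : Measurable fun v : Space d × 𝔸 => ENNReal.ofReal (originProb φ a v) :=
    (measurable_subtype_coe.comp ((measurable_originProb hφ hα).comp
      measurable_prodMk_left)).ennreal_ofReal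
  rw [intensity, mixingParam,
    lintegral_prod (fun q : Pt d 𝔸 α => ENNReal.ofReal (originProb φ a (Pt.vertex q)))
      (hm.comp measurable_vertex).aemeasurable,
    lintegral_smul_measure, smul_eq_mul]
  congr 1
  refine lintegral_congr fun y => ?_
  rw [lintegral_prod]
  · simp [Pt.vertex, originProb]
  · exact (hm.comp (measurable_vertex.comp measurable_prodMk_left)).aemeasurable

lemma measurable_mixingParam (γ : ℝ) (Θ : Measure 𝔸) [IsProbabilityMeasure Θ]
    (hφ : IsConnectionFamily α φ) (hα : 1 ≤ α) : Measurable (mixingParam γ Θ φ) := by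
  refine Measurable.const_mul (Measurable.lintegral_prod_right' (f := fun p : 𝔸 × Space d =>
    ∫⁻ b : 𝔸, ENNReal.ofReal (φ 1 ![(0, p.1), (p.2, b)] : ℝ) ∂Θ) ?_) _
  refine Measurable.lintegral_prod_right' (f := fun p : (𝔸 × Space d) × 𝔸 =>
    ENNReal.ofReal (φ 1 ![(0, p.1.1), (p.1.2, p.2)] : ℝ)) ?_
  exact (measurable_subtype_coe.comp ((measurable_originProb hφ hα).comp
    ((measurable_fst.comp measurable_fst).prodMk
      ((measurable_snd.comp measurable_fst).prodMk measurable_snd)))).ennreal_ofReal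

variable [Nonempty 𝔸] {Ω : Type*} [MeasurableSpace Ω] {P : Measure Ω}
  {γ : ℝ} {Θ : Measure 𝔸} [IsProbabilityMeasure Θ] {Ψ : Ω → Config d 𝔸 α}

/-- Integrating out the decoration and then the Poisson process costs a factor `2` each time. The
second step is applied to `2s` times a probability, hence the condition `2 * s ≤ 1`. -/
lemma lintegral_lintegral_eexp_degree_le (hφ : IsConnectionFamily α φ) (hα : 1 ≤ α)
    (enum : ℕ ≃ (Fin d → ℤ))
    (hΨ : IsPoissonProcess (fun ω => (Ψ ω).1) (intensity d α γ Θ) P) (a : 𝔸)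
    {s : ℝ≥0∞} (hs : 2 * s ≤ 1) :
    ∫⁻ ω, ∫⁻ u, eexp (s * degree φ hα (record enum (Ψ ω)) a u) ∂(decorLaw α) ∂P ≤
      eexp (4 * (s * mixingParam γ Θ φ a)) := by
  classical
  have hm : Measurable fun q : Pt d 𝔸 α => ENNReal.ofReal (originProb φ a (Pt.vertex q)) :=
    (measurable_subtype_coe.comp ((measurable_originProb hφ hα).comp
      (measurable_prodMk_left.comp measurable_vertex))).ennreal_ofReal
  have hs1 : s ≤ 1 := le_trans (by rw [two_mul]; exact le_self_add) hs
  calc ∫⁻ ω, ∫⁻ u, eexp (s * degree φ hα (record enum (Ψ ω)) a u) ∂(decorLaw α) ∂P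
      ≤ ∫⁻ ω, eexp (∫⁻ q, 2 * s * ENNReal.ofReal (originProb φ a (Pt.vertex q)) ∂(Ψ ω).1) ∂P := by
        refine lintegral_mono fun ω => (lintegral_eexp_degree_le hα _ a hs1).trans (eexp_mono ?_)
        rw [lintegral_const_mul _ hm, mul_assoc]
        gcongr
        rw [ENNReal.tsum_eq_iSup_sum]
        exact iSup_le fun F => sum_pointAt_le_lintegral enum (Ψ ω) hm F
    _ ≤ eexp (2 * ∫⁻ q, 2 * s * ENNReal.ofReal (originProb φ a (Pt.vertex q))
          ∂(intensity d α γ Θ)) := by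
        refine hΨ.lintegral_eexp_le (hm.const_mul _) fun q => ?_
        refine mul_le_one' hs ?_
        rw [ENNReal.ofReal_le_one]
        exact (originProb φ a (Pt.vertex q)).2.2
    _ = eexp (4 * (s * mixingParam γ Θ φ a)) := by
        rw [lintegral_const_mul _ hm, lintegral_originProb γ Θ hφ hα]
        congr 1
        ring

/-- The constant in the bound for the moments of the degree. -/
def degreeConst (m : ℕ) : ℝ≥0∞ := 4 ^ m * (m.factorial * eexp 1)

lemma degreeConst_ne_top (m : ℕ) : degreeConst m ≠ ∞ := by
  refine ENNReal.mul_ne_top (by finiteness) (ENNReal.mul_ne_top (by finiteness) ?_)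
  exact ne_top_of_le_ne_top (by finiteness) (eexp_le_one_add_two_mul le_rfl)

lemma lintegral_lintegral_degree_pow_le (hφ : IsConnectionFamily α φ) (hα : 1 ≤ α)
    (enum : ℕ ≃ (Fin d → ℤ))
    (hΨ : IsPoissonProcess (fun ω => (Ψ ω).1) (intensity d α γ Θ) P) (a : 𝔸) {m : ℕ}
    (hm : m ≠ 0) :
    ∫⁻ ω, ∫⁻ u, degree φ hα (record enum (Ψ ω)) a u ^ m ∂(decorLaw α) ∂P ≤
      degreeConst m * (1 + mixingParam γ Θ φ a) ^ m := by
  set π := mixingParam γ Θ φ a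
  have h0 : degreeConst m ≠ 0 := by
    refine mul_ne_zero (by positivity) (mul_ne_zero (by simp [Nat.factorial_ne_zero]) ?_)
    exact (zero_lt_one.trans_le (le_self_add.trans (one_add_le_eexp 1))).ne'
  -- For infinite `π` the right-hand side is infinite because `m ≠ 0`.
  by_cases hπ : π = ∞
  · rw [hπ]
    simp [ENNReal.top_pow hm, ENNReal.mul_top h0]
  -- The exponential bound is used at `s = M⁻¹`: then `4 * s * π ≤ 1` and `2 * s ≤ 1`, and the
  -- summand `1` keeps `M` nonzero when `π = 0`.
  set M := 4 * (1 + π) with hM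
  have hM0 : M ≠ 0 := by simp [hM]
  have hMt : M ≠ ∞ := by finiteness
  have hMc : M * M⁻¹ = 1 := ENNReal.mul_inv_cancel hM0 hMt
  have hs : 2 * M⁻¹ ≤ 1 := by
    rw [← hMc]
    gcongr
    calc (2 : ℝ≥0∞) ≤ 4 * 1 := by norm_num
      _ ≤ M := by rw [hM]; gcongr; exact le_self_add
  have hsπ : 4 * (M⁻¹ * π) ≤ 1 := by
    rw [← hMc]
    calc 4 * (M⁻¹ * π) = (4 * π) * M⁻¹ := by ring
      _ ≤ M * M⁻¹ := by rw [hM]; gcongr; exact le_add_self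
  have hpow : ∀ x : ℝ≥0∞, x ^ m ≤ M ^ m * m.factorial * eexp (M⁻¹ * x) := by
    intro x
    calc x ^ m = M ^ m * (M⁻¹ * x) ^ m := by
          rw [← mul_pow, ← mul_assoc, hMc, one_mul]
      _ ≤ M ^ m * (m.factorial * eexp (M⁻¹ * x)) := by
          gcongr
          exact pow_le_factorial_mul_eexp _ m
      _ = _ := by ring
  have hC : M ^ m * m.factorial ≠ ∞ := by finiteness
  calc ∫⁻ ω, ∫⁻ u, degree φ hα (record enum (Ψ ω)) a u ^ m ∂(decorLaw α) ∂P
      ≤ ∫⁻ ω, ∫⁻ u, M ^ m * m.factorial * eexp (M⁻¹ * degree φ hα (record enum (Ψ ω)) a u)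
          ∂(decorLaw α) ∂P := lintegral_mono fun ω => lintegral_mono fun u => hpow _
    _ = M ^ m * m.factorial * ∫⁻ ω, ∫⁻ u, eexp (M⁻¹ * degree φ hα (record enum (Ψ ω)) a u)
          ∂(decorLaw α) ∂P := by
        simp_rw [lintegral_const_mul' _ _ hC]
    _ ≤ M ^ m * m.factorial * eexp 1 := by
        gcongr
        exact (lintegral_lintegral_eexp_degree_le hφ hα enum hΨ a hs).trans (eexp_mono hsπ)
    _ = degreeConst m * (1 + π) ^ m := by
        rw [degreeConst, hM, mul_pow]
        ring

/-- Moments of the degree of the origin are controlled by moments of the mixing parameter. -/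
lemma lintegral_degree_pow_le (hφ : IsConnectionFamily α φ) (hα : 1 ≤ α)
    [IsProbabilityMeasure P] (enum : ℕ ≃ (Fin d → ℤ)) (hΨm : Measurable Ψ)
    (hΨ : IsPoissonProcess (fun ω => (Ψ ω).1) (intensity d α γ Θ) P)
    {V : Ω → 𝔸} (hV : Measurable V) (hVlaw : P.map V = Θ)
    {U : Ω → Decor α} (hU : Measurable U) (hUlaw : P.map U = decorLaw α)
    (hVU : IndepFun V U P) (hΨVU : IndepFun Ψ (fun ω => (V ω, U ω)) P) {m : ℕ} (hm : m ≠ 0) :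
    ∫⁻ ω, degree φ hα (record enum (Ψ ω)) (V ω) (U ω) ^ m ∂P ≤
      degreeConst m * ∫⁻ ω, (1 + mixingParam γ Θ φ (V ω)) ^ m ∂P := by
  have hY : Measurable fun ω => record enum (Ψ ω) := (measurable_record enum).comp hΨm
  have hg := (measurable_degree hφ hα).pow_const m
  have hind : IndepFun (fun ω => record enum (Ψ ω)) (fun ω => (V ω, U ω)) P :=
    hΨVU.comp (measurable_record enum) measurable_id
  have hYp : IsProbabilityMeasure (P.map fun ω => record enum (Ψ ω)) :=
    Measure.isProbabilityMeasure_map hY.aemeasurable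
  have hlaw : P.map (fun ω => (record enum (Ψ ω), (V ω, U ω))) =
      (P.map fun ω => record enum (Ψ ω)).prod (Θ.prod (decorLaw α)) := by
    rw [(indepFun_iff_map_prod_eq_prod_map_map hY.aemeasurable
      (hV.prodMk hU).aemeasurable).1 hind,
      (indepFun_iff_map_prod_eq_prod_map_map hV.aemeasurable hU.aemeasurable).1 hVU, hVlaw, hUlaw]
  have hinner : Measurable fun p : (ℕ × ℕ → Pt d 𝔸 α × Prop) × 𝔸 =>
      ∫⁻ u, degree φ hα p.1 p.2 u ^ m ∂(decorLaw α) :=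
    Measurable.lintegral_prod_right' (f := fun p : ((ℕ × ℕ → Pt d 𝔸 α × Prop) × 𝔸) × Decor α =>
      degree φ hα p.1.1 p.1.2 p.2 ^ m) (hg.comp ((measurable_fst.comp measurable_fst).prodMk
        ((measurable_snd.comp measurable_fst).prodMk measurable_snd)))
  have hπ : Measurable fun a => degreeConst m * (1 + mixingParam γ Θ φ a) ^ m :=
    (((measurable_mixingParam γ Θ hφ hα).const_add 1).pow_const m).const_mul _
  calc ∫⁻ ω, degree φ hα (record enum (Ψ ω)) (V ω) (U ω) ^ m ∂P
      = ∫⁻ p, degree φ hα p.1 p.2.1 p.2.2 ^ m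
          ∂(P.map (fun ω => (record enum (Ψ ω), (V ω, U ω)))) :=
        (lintegral_map hg (hY.prodMk (hV.prodMk hU))).symm
    _ = ∫⁻ Y, ∫⁻ a, ∫⁻ u, degree φ hα Y a u ^ m ∂(decorLaw α) ∂Θ
          ∂(P.map fun ω => record enum (Ψ ω)) := by
        rw [hlaw, lintegral_prod _ hg.aemeasurable]
        refine lintegral_congr fun Y => ?_
        exact lintegral_prod _ (hg.comp measurable_prodMk_left).aemeasurable
    -- The mark is moved outermost, so that the bound for a fixed mark applies.
    _ = ∫⁻ a, ∫⁻ Y, ∫⁻ u, degree φ hα Y a u ^ m ∂(decorLaw α)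
          ∂(P.map fun ω => record enum (Ψ ω)) ∂Θ :=
        lintegral_lintegral_swap hinner.aemeasurable
    _ ≤ ∫⁻ a, degreeConst m * (1 + mixingParam γ Θ φ a) ^ m ∂Θ := by
        refine lintegral_mono fun a => ?_
        refine le_trans (le_of_eq ?_) (lintegral_lintegral_degree_pow_le hφ hα enum hΨ a hm)
        exact lintegral_map (hinner.comp (measurable_prodMk_right (y := a))) hY
    _ = degreeConst m * ∫⁻ ω, (1 + mixingParam γ Θ φ (V ω)) ^ m ∂P := by
        rw [← hVlaw, lintegral_map (hVlaw ▸ hπ) hV, hVlaw,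
          lintegral_const_mul' _ _ (degreeConst_ne_top m)]

end Degree

/-! ### The Euler characteristic of a complex of bounded dimension -/

section Euler

variable {X : Type*}

/-- A summation range independent of the complex allows two Euler characteristics to be subtracted
term by term. -/
lemma eulerChar_eq_sum {K : PreAbstractSimplicialComplex X} {n : ℕ}
    (hK : ∀ σ ∈ K.faces, σ.card ≤ n + 1) :
    eulerChar K = ∑ i ∈ Finset.range (n + 1), (-1 : ℝ) ^ i * (simplexCount K i : ℝ) := by
  have hub : ∀ m ∈ (fun σ : Finset X => σ.card - 1) '' K.faces, m ≤ n := by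
    rintro _ ⟨σ, hσ, rfl⟩
    have := hK σ hσ
    dsimp only
    omega
  have hdim : complexDim K ≤ n := csSup_le' hub
  refine Finset.sum_subset (Finset.range_mono (by omega)) fun i _ hi => ?_
  have h0 : {σ ∈ K.faces | σ.card = i + 1} = ∅ := by
    refine Set.eq_empty_of_forall_notMem fun σ hσ => hi ?_
    have : σ.card - 1 ≤ complexDim K := le_csSup ⟨n, hub⟩ ⟨σ, hσ.1, rfl⟩
    have h2 := hσ.2
    rw [Finset.mem_range]
    omega
  simp [simplexCount, h0]

lemma isTranslationInvariant_eulerChar {d : ℕ} {𝔸 : Type*} :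
    IsTranslationInvariant (eulerChar : PreAbstractSimplicialComplex (Space d × 𝔸) → ℝ) := by
  classical
  intro K s _
  have hinj : Function.Injective fun v : Space d × 𝔸 => (v.1 + s, v.2) := by
    intro v w h
    simp only [Prod.mk.injEq, add_left_inj] at h
    exact Prod.ext h.1 h.2
  have hcard : ∀ σ : Finset (Space d × 𝔸),
      (σ.image fun v => (v.1 + s, v.2)).card = σ.card := fun σ =>
    Finset.card_image_of_injective σ hinj
  have hfaces : (translate K s).faces =
      (fun σ : Finset (Space d × 𝔸) => σ.image fun v => (v.1 + s, v.2)) '' K.faces := by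
    simp only [translate, PreAbstractSimplicialComplex.map]
  have hcount : ∀ i, simplexCount (translate K s) i = simplexCount K i := by
    intro i
    rw [simplexCount, simplexCount, hfaces,
      ← Set.ncard_image_of_injective {σ ∈ K.faces | σ.card = i + 1}
        (Finset.image_injective hinj)]
    congr 1
    ext τ
    constructor
    · rintro ⟨⟨σ, hσ, rfl⟩, h⟩
      exact ⟨σ, ⟨hσ, (hcard σ).symm.trans h⟩, rfl⟩
    · rintro ⟨σ, ⟨hσ, h⟩, rfl⟩
      exact ⟨⟨σ, hσ, rfl⟩, (hcard σ).trans h⟩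
  have hdim : complexDim (translate K s) = complexDim K := by
    rw [complexDim, complexDim, hfaces, Set.image_image]
    simp_rw [hcard]
  simp_rw [eulerChar, hcount, hdim]

end Euler

/-! ### Adding a point at the origin -/

section Added

variable {d α : ℕ} {𝔸 : Type*}

/-- The added point `(0, a, 1, u)`. -/
def originPt (a : 𝔸) (u : Decor α) : Pt d 𝔸 α := (0, a, 1, u)

/-- The points of the configuration with added point, as a function of the coordinates; the index
`none` stands for the added point. -/
def labelPt (Y : ℕ × ℕ → Pt d 𝔸 α × Prop) (a : 𝔸) (u : Decor α) : Option (ℕ × ℕ) → Pt d 𝔸 α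
  | none => originPt a u
  | some κ => (Y κ).1

/-- The labels of existing points. -/
def LabelPresent (Y : ℕ × ℕ → Pt d 𝔸 α × Prop) : Option (ℕ × ℕ) → Prop
  | none => True
  | some κ => (Y κ).2

/-- The coordinates belonging to a label, with a dummy value for the added point. -/
def labelCoords (o : Option (ℕ × ℕ)) : ℕ × ℕ := o.getD 0

variable [MeasurableSpace 𝔸] {enum : ℕ ≃ (Fin d → ℤ)}
  {φ : (j : ℕ) → (Fin (j + 1) → Space d × 𝔸) → unitInterval}

/-- The complex with the added vertex at the origin. -/
def originComplex (enum : ℕ ≃ (Fin d → ℤ))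
    (φ : (j : ℕ) → (Fin (j + 1) → Space d × 𝔸) → unitInterval)
    (ψ : Measure (Pt d 𝔸 α)) (a : 𝔸) (u : Decor α) : PreAbstractSimplicialComplex (Space d × 𝔸) :=
  complexOf enum φ (ψ + Measure.dirac (originPt a u))

lemma card_le_of_mem_originComplex {ψ : Measure (Pt d 𝔸 α)} {a : 𝔸} {u : Decor α}
    {σ : Finset (Space d × 𝔸)} (hσ : σ ∈ (originComplex enum φ ψ a u).faces) :
    σ.card ≤ α + 1 := by
  obtain ⟨j, hj, p, hp, hσ⟩ := hσ
  have h : σ.card = j + 1 := by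
    rw [← Set.ncard_coe_finset, hσ, ← Set.image_univ, Set.ncard_image_of_injective _ hp.2.2.1,
      Set.ncard_univ, Nat.card_eq_fintype_card, Fintype.card_fin]
  omega

variable [StandardBorelSpace 𝔸]

lemma points_add_dirac {X : Type*} [MeasurableSpace X] [MeasurableSingletonClass X]
    (η : Measure X) (y : X) : points (η + Measure.dirac y) = insert y (points η) := by
  ext z
  simp only [points, Set.mem_ofPred_eq, Set.mem_insert_iff, Measure.add_apply, ne_eq,
    add_eq_zero, Measure.dirac_apply' _ (measurableSet_singleton z)]
  by_cases h : z = y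
  · simp [h]
  · have : y ∉ ({z} : Set X) := fun hy => h hy.symm
    simp [h, this]

/-- A rank counts only points that are not later, so adding a strictly later point leaves it
unchanged. -/
lemma coords_add_dirac (ψ : Measure (Pt d 𝔸 α)) {y q : Pt d 𝔸 α} (h : Pt.time q < Pt.time y) :
    coords enum (ψ + Measure.dirac y) q = coords enum ψ q := by
  unfold coords
  congr 2
  ext z
  simp only [points_add_dirac, Set.mem_ofPred_eq, Set.mem_insert_iff]
  constructor
  · rintro ⟨rfl | hz, hc, ht⟩
    · exact absurd ht (not_le.2 h)
    · exact ⟨hz, hc, ht⟩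
  · rintro ⟨hz, hc, ht⟩
    exact ⟨Or.inr hz, hc, ht⟩

variable [Nonempty 𝔸] {ψ : Config d 𝔸 α} {a : 𝔸} {u : Decor α}

lemma HasDistinctTimes.coords_labelPt (h : HasDistinctTimes enum ψ.1) {o : Option (ℕ × ℕ)}
    (ho : LabelPresent (record enum ψ) o) (ht : Pt.time (labelPt (record enum ψ) a u o) < 1) :
    coords enum (ψ.1 + Measure.dirac (originPt a u)) (labelPt (record enum ψ) a u o) =
      labelCoords o := by
  cases o with
  | none => exact absurd ht (lt_irrefl _)
  | some κ =>
    rw [coords_add_dirac _ ht]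
    exact h.coords_pointAt ho

lemma HasDistinctTimes.mem_points_iff (h : HasDistinctTimes enum ψ.1) (q : Pt d 𝔸 α) :
    q ∈ points (ψ.1 + Measure.dirac (originPt a u)) ↔
      ∃ o, LabelPresent (record enum ψ) o ∧ labelPt (record enum ψ) a u o = q := by
  rw [points_add_dirac]
  constructor
  · rintro (rfl | hq)
    · exact ⟨none, trivial, rfl⟩
    · exact ⟨some (coords enum ψ.1 q), h.isPresent_coords hq⟩
  · rintro ⟨_ | κ, ho, rfl⟩
    · exact Or.inl rfl
    · exact Or.inr (pointAt_mem ho).1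

/-- The points with the given labels span a simplex over `W`. -/
def IsLabelledSimplex (φ : (j : ℕ) → (Fin (j + 1) → Space d × 𝔸) → unitInterval)
    (W : Set (Space d)) (Y : ℕ × ℕ → Pt d 𝔸 α × Prop) (a : 𝔸) (u : Decor α) {j : ℕ}
    (T : Fin (j + 1) → Option (ℕ × ℕ)) : Prop :=
  (∀ i, LabelPresent Y (T i)) ∧ (∀ i i', i < i' → Pt.time (labelPt Y a u (T i)) <
    Pt.time (labelPt Y a u (T i'))) ∧
  (∀ i i', i ≠ i' → Pt.vertex (labelPt Y a u (T i)) ≠ Pt.vertex (labelPt Y a u (T i'))) ∧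
  (∀ i, (labelPt Y a u (T i)).1 ∈ W) ∧
  ∀ (k : Fin α) (s : Fin ((k : ℕ) + 1 + 1) ↪o Fin (j + 1)),
    Pt.decor (labelPt Y a u (T (s (Fin.last ((k : ℕ) + 1)))))
      ⟨k, fun i => labelCoords (T (s i.castSucc))⟩
      ≤ φ ((k : ℕ) + 1) (fun i => Pt.vertex (labelPt Y a u (T (s i))))

/-- The simplex condition uses coordinates only of points strictly earlier than some other point.
Their time is below `1`, so the added point neither changes their coordinates nor has its own dummy
coordinates read. -/
lemma HasDistinctTimes.isOrderedSimplex_iff (h : HasDistinctTimes enum ψ.1) (W : Set (Space d))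
    {j : ℕ} {T : Fin (j + 1) → Option (ℕ × ℕ)} (hT : ∀ i, LabelPresent (record enum ψ) (T i)) :
    IsLabelledSimplex φ W (record enum ψ) a u T ↔
      IsOrderedSimplex enum φ (ψ.1 + Measure.dirac (originPt a u))
        (fun i => labelPt (record enum ψ) a u (T i)) ∧
        ∀ i, (labelPt (record enum ψ) a u (T i)).1 ∈ W := by
  have key : (StrictMono fun i => Pt.time (labelPt (record enum ψ) a u (T i))) →
      ∀ (k : Fin α) (s : Fin ((k : ℕ) + 1 + 1) ↪o Fin (j + 1)),
      (fun i : Fin ((k : ℕ) + 1) => coords enum (ψ.1 + Measure.dirac (originPt a u))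
        (labelPt (record enum ψ) a u (T (s i.castSucc)))) =
      fun i => labelCoords (T (s i.castSucc)) := by
    intro hmono k s
    funext i
    refine h.coords_labelPt (hT _) ?_
    exact (hmono (s.strictMono (Fin.castSucc_lt_last i))).trans_le unitInterval.le_one'
  constructor
  · rintro ⟨-, hmono, hinj, hW, hs⟩
    have hm : StrictMono fun i => Pt.time (labelPt (record enum ψ) a u (T i)) := hmono
    refine ⟨⟨fun i => (h.mem_points_iff _).2 ⟨_, hT i, rfl⟩, hm, ?_, fun k s => ?_⟩, hW⟩
    · intro i i' hii
      by_contra hne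
      exact hinj i i' hne hii
    · rw [key hm k s]
      exact hs k s
  · rintro ⟨⟨-, hm, hinj, hs⟩, hW⟩
    refine ⟨hT, fun i i' hlt => hm hlt, fun i i' hne he => hne (hinj he), hW, fun k s => ?_⟩
    rw [← key hm k s]
    exact hs k s

-- Faces become a family indexed by countably many label tuples, with conditions that depend only on
-- the record, the mark and the decoration.
open Classical in
lemma HasDistinctTimes.setOf_faces_eq (h : HasDistinctTimes enum ψ.1) (W : Set (Space d))
    {i : ℕ} (hi : i ≤ α) :
    {σ ∈ (restrictTo (originComplex enum φ ψ.1 a u) (W ×ˢ Set.univ)).faces | σ.card = i + 1} =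
      {σ | ∃ T : Fin (i + 1) → Option (ℕ × ℕ), IsLabelledSimplex φ W (record enum ψ) a u T ∧
        σ = Finset.univ.image fun l => Pt.vertex (labelPt (record enum ψ) a u (T l))} := by
  ext σ
  constructor
  · rintro ⟨⟨⟨j, hj, p, hp, hσ⟩, hW⟩, hcard⟩
    have hc : σ.card = j + 1 := by
      rw [← Set.ncard_coe_finset, hσ, ← Set.image_univ, Set.ncard_image_of_injective _ hp.2.2.1,
        Set.ncard_univ, Nat.card_eq_fintype_card, Fintype.card_fin]
    obtain rfl : j = i := by omega
    choose T hT hTp using fun l => (h.mem_points_iff (p l)).1 (hp.1 l)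
    obtain rfl : (fun l => labelPt (record enum ψ) a u (T l)) = p := funext hTp
    refine ⟨T, (h.isOrderedSimplex_iff W hT).2 ⟨hp, fun l => ?_⟩, ?_⟩
    · refine (hW (Pt.vertex (labelPt (record enum ψ) a u (T l))) ?_).1
      rw [← Finset.mem_coe, hσ]
      exact ⟨l, rfl⟩
    · rw [← Finset.coe_inj, hσ]
      simp
  · rintro ⟨T, hT, rfl⟩
    obtain ⟨hp, hW⟩ := (h.isOrderedSimplex_iff W hT.1).1 hT
    refine ⟨⟨⟨i, hi, _, hp, by simp⟩, ?_⟩, ?_⟩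
    · intro v hv
      obtain ⟨l, -, rfl⟩ := Finset.mem_image.1 hv
      exact ⟨hW l, trivial⟩
    · rw [Finset.card_image_of_injective _ hp.2.2.1, Finset.card_univ, Fintype.card_fin]

end Added

/-! ### Measurability -/

section Measurability

/-- Having at least `N` elements means that some `N` indices are active with pairwise different
values: a countable union of measurable events. -/
lemma measurable_ncard_exists {Ω' X ι : Type*} [MeasurableSpace Ω'] [Countable ι]
    {E : ι → Set Ω'} {g : ι → Ω' → X} (hE : ∀ n, MeasurableSet (E n))
    (hg : ∀ m n, MeasurableSet {ω | g m ω = g n ω}) :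
    Measurable fun ω => {x | ∃ n, ω ∈ E n ∧ x = g n ω}.ncard := by
  set S : Ω' → Set X := fun ω => {x | ∃ n, ω ∈ E n ∧ x = g n ω} with hS
  have key : ∀ N : ℕ, MeasurableSet {ω | (N : ℕ∞) ≤ (S ω).encard} := by
    intro N
    have hset : {ω | (N : ℕ∞) ≤ (S ω).encard} = ⋃ t : Fin N → ι,
        ((⋂ l, E (t l)) ∩ ⋂ l, ⋂ l', ⋂ _ : l ≠ l', {ω | g (t l) ω = g (t l') ω}ᶜ) := by
      ext ω
      simp only [Set.mem_ofPred_eq, Set.mem_iUnion, Set.mem_inter_iff, Set.mem_iInter,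
        Set.mem_compl_iff]
      constructor
      · intro h
        obtain ⟨A, hA, hAc⟩ := Set.exists_subset_encard_eq h
        have hfin : A.Finite := Set.finite_of_encard_eq_coe hAc
        have hcard : Nat.card A = N := by
          have := hfin.cast_ncard_eq.trans hAc
          exact_mod_cast this
        have : Finite A := hfin
        let e := (Finite.equivFinOfCardEq hcard).symm
        choose t ht hte using fun l => hA (e l).2
        refine ⟨t, ht, fun l l' hne he => hne (e.injective (Subtype.ext ?_))⟩
        rw [hte l, hte l', he]
      · rintro ⟨t, ht, hne⟩
        have hinj : Function.Injective fun l => g (t l) ω := by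
          intro l l' h
          by_contra hll
          exact hne l l' hll h
        calc (N : ℕ∞) = (Set.range fun l => g (t l) ω).encard := by
              rw [← Set.image_univ, hinj.encard_image, Set.encard_univ, ENat.card_eq_coe_fintype_card,
                Fintype.card_fin]
          _ ≤ (S ω).encard := by
              refine Set.encard_le_encard ?_
              rintro _ ⟨l, rfl⟩
              exact ⟨t l, ht l, rfl⟩
    rw [hset]
    refine MeasurableSet.iUnion fun t => (MeasurableSet.iInter fun l => hE _).inter ?_
    exact MeasurableSet.iInter fun l => MeasurableSet.iInter fun l' => MeasurableSet.iInter
      fun _ => (hg _ _).compl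
  -- `ncard` is `0` on infinite sets, so this event has to be removed from the upper level sets
  -- below.
  have htop : MeasurableSet {ω | (S ω).encard = ⊤} := by
    have : {ω | (S ω).encard = ⊤} = ⋂ N : ℕ, {ω | (N : ℕ∞) ≤ (S ω).encard} := by
      ext ω
      simp only [Set.mem_ofPred_eq, Set.mem_iInter]
      exact ENat.eq_top_iff_forall_ge
    rw [this]
    exact MeasurableSet.iInter key
  refine measurable_of_Ici fun n => ?_
  rcases n with _ | n
  · convert MeasurableSet.univ
    ext ω
    simp
  · have : (fun ω => (S ω).ncard) ⁻¹' Set.Ici (n + 1) =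
        {ω | ((n + 1 : ℕ) : ℕ∞) ≤ (S ω).encard} \ {ω | (S ω).encard = ⊤} := by
      ext ω
      simp only [Set.mem_preimage, Set.mem_Ici, Set.mem_sdiff, Set.mem_ofPred_eq]
      rcases (S ω).finite_or_infinite with h | h
      · rw [← h.cast_ncard_eq]
        simp only [ENat.natCast_ne_top, not_false_eq_true, and_true]
        exact Nat.cast_le.symm
      · simp [h.ncard, h.encard_eq]
    rw [this]
    exact (key _).diff htop

variable {d α : ℕ} {𝔸 : Type*} [MeasurableSpace 𝔸]

lemma measurable_labelPt (o : Option (ℕ × ℕ)) :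
    Measurable fun z : (ℕ × ℕ → Pt d 𝔸 α × Prop) × 𝔸 × Decor α =>
      labelPt z.1 z.2.1 z.2.2 o := by
  cases o with
  | none => exact measurable_const.prodMk ((measurable_fst.comp measurable_snd).prodMk
      (measurable_const.prodMk (measurable_snd.comp measurable_snd)))
  | some κ => exact measurable_fst.comp ((measurable_pi_apply κ).comp measurable_fst)

variable [StandardBorelSpace 𝔸] {φ : (j : ℕ) → (Fin (j + 1) → Space d × 𝔸) → unitInterval}

lemma measurableSet_isLabelledSimplex (hφ : IsConnectionFamily α φ) {W : Set (Space d)}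
    (hW : MeasurableSet W) {j : ℕ} (T : Fin (j + 1) → Option (ℕ × ℕ)) :
    MeasurableSet {z : (ℕ × ℕ → Pt d 𝔸 α × Prop) × 𝔸 × Decor α |
      IsLabelledSimplex φ W z.1 z.2.1 z.2.2 T} := by
  have hv := fun i => measurable_vertex.comp (measurable_labelPt (d := d) (α := α) (𝔸 := 𝔸) (T i))
  have ht := fun i => measurable_time.comp (measurable_labelPt (d := d) (α := α) (𝔸 := 𝔸) (T i))
  simp only [IsLabelledSimplex, Set.ofPred_and, Set.ofPred_forall]
  refine MeasurableSet.inter ?_ (MeasurableSet.inter ?_ (MeasurableSet.inter ?_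
    (MeasurableSet.inter ?_ ?_)))
  · refine MeasurableSet.iInter fun i => ?_
    cases T i with
    | none => exact MeasurableSet.univ
    | some κ =>
      exact measurableSet_setOfPred.2
        (measurable_snd.comp ((measurable_pi_apply κ).comp measurable_fst))
  · exact MeasurableSet.iInter fun i => MeasurableSet.iInter fun i' => MeasurableSet.iInter
      fun _ => measurableSet_lt (ht i) (ht i')
  · exact MeasurableSet.iInter fun i => MeasurableSet.iInter fun i' => MeasurableSet.iInter
      fun _ => (measurableSet_eq_fun (hv i) (hv i')).compl
  · exact MeasurableSet.iInter fun i => (measurable_fst.comp (measurable_labelPt (T i))) hW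
  · refine MeasurableSet.iInter fun k => MeasurableSet.iInter fun s => ?_
    refine measurableSet_le ?_ ?_
    · exact (measurable_pi_apply _).comp (measurable_decor.comp (measurable_labelPt _))
    · exact (hφ.measurable _ (by omega) (by omega)).comp (measurable_pi_lambda _ fun i => hv _)

open Classical in
lemma measurable_ncard_labelledSimplex (hφ : IsConnectionFamily α φ) {W : Set (Space d)}
    (hW : MeasurableSet W) (i : ℕ) :
    Measurable fun z : (ℕ × ℕ → Pt d 𝔸 α × Prop) × 𝔸 × Decor α =>
      {σ : Finset (Space d × 𝔸) | ∃ T : Fin (i + 1) → Option (ℕ × ℕ),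
        IsLabelledSimplex φ W z.1 z.2.1 z.2.2 T ∧
        σ = Finset.univ.image fun l => Pt.vertex (labelPt z.1 z.2.1 z.2.2 (T l))}.ncard := by
  refine measurable_ncard_exists (measurableSet_isLabelledSimplex hφ hW) fun T T' => ?_
  have hv := fun o => measurable_vertex.comp (measurable_labelPt (d := d) (α := α) (𝔸 := 𝔸) o)
  have hset : {z : (ℕ × ℕ → Pt d 𝔸 α × Prop) × 𝔸 × Decor α |
      (Finset.univ.image fun l => Pt.vertex (labelPt z.1 z.2.1 z.2.2 (T l))) =
        Finset.univ.image fun l => Pt.vertex (labelPt z.1 z.2.1 z.2.2 (T' l))} =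
      (⋂ l, ⋃ l', {z | Pt.vertex (labelPt z.1 z.2.1 z.2.2 (T' l')) =
        Pt.vertex (labelPt z.1 z.2.1 z.2.2 (T l))}) ∩
      ⋂ l, ⋃ l', {z | Pt.vertex (labelPt z.1 z.2.1 z.2.2 (T l')) =
        Pt.vertex (labelPt z.1 z.2.1 z.2.2 (T' l))} := by
    ext z
    simp [Finset.Subset.antisymm_iff, Finset.image_subset_iff]
  rw [hset]
  exact (MeasurableSet.iInter fun l => MeasurableSet.iUnion fun l' =>
    measurableSet_eq_fun (hv _) (hv _)).inter (MeasurableSet.iInter fun l =>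
    MeasurableSet.iUnion fun l' => measurableSet_eq_fun (hv _) (hv _))

end Measurability

/-! ### The star of the origin -/

section Star

variable {d α : ℕ} {𝔸 : Type*} [MeasurableSpace 𝔸] {enum : ℕ ≃ (Fin d → ℤ)}
  {φ : (j : ℕ) → (Fin (j + 1) → Space d × 𝔸) → unitInterval}

/-- The `i`-simplices that contain the added vertex. -/
def originStar (enum : ℕ ≃ (Fin d → ℤ))
    (φ : (j : ℕ) → (Fin (j + 1) → Space d × 𝔸) → unitInterval)
    (ψ : Measure (Pt d 𝔸 α)) (a : 𝔸) (u : Decor α) (i : ℕ) : Set (Finset (Space d × 𝔸)) :=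
  {σ ∈ (originComplex enum φ ψ a u).faces | σ.card = i + 1 ∧ ((0 : Space d), a) ∈ σ}

/-- The coordinates of the potential neighbours of the added vertex. -/
def neighbours (enum : ℕ ≃ (Fin d → ℤ)) [Nonempty 𝔸]
    (φ : (j : ℕ) → (Fin (j + 1) → Space d × 𝔸) → unitInterval) (hα : 1 ≤ α)
    (ψ : Config d 𝔸 α) (a : 𝔸) (u : Decor α) : Set (ℕ × ℕ) :=
  {κ | (record enum ψ κ).2 ∧
    u (edgeIndex hα κ) ≤ originProb φ a (Pt.vertex (record enum ψ κ).1)}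

lemma degree_eq_encard [Nonempty 𝔸] (hα : 1 ≤ α) (ψ : Config d 𝔸 α) (a : 𝔸) (u : Decor α) :
    degree φ hα (record enum ψ) a u = ((neighbours enum φ hα ψ a u).encard : ℝ≥0∞) := by
  classical
  rw [← ENNReal.tsum_set_one,
    tsum_subtype (neighbours enum φ hα ψ a u) (fun _ => (1 : ℝ≥0∞)), degree]
  refine tsum_congr fun κ => ?_
  by_cases h : κ ∈ neighbours enum φ hα ψ a u
  · rw [Set.indicator_of_mem h]
    exact if_pos h
  · rw [Set.indicator_of_notMem h]
    exact if_neg h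

variable [StandardBorelSpace 𝔸] [Nonempty 𝔸] {ψ : Config d 𝔸 α} {a : 𝔸} {u : Decor α}

lemma HasDistinctTimes.exists_label (h : HasDistinctTimes enum ψ.1) {σ : Finset (Space d × 𝔸)}
    (hσ : σ ∈ (originComplex enum φ ψ.1 a u).faces) {v : Space d × 𝔸} (hv : v ∈ σ) :
    ∃ o, LabelPresent (record enum ψ) o ∧ Pt.vertex (labelPt (record enum ψ) a u o) = v := by
  obtain ⟨j, -, p, hp, hσ⟩ := hσ
  rw [← Finset.mem_coe, hσ] at hv
  obtain ⟨l, rfl⟩ := hv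
  obtain ⟨o, ho, hop⟩ := (h.mem_points_iff (p l)).1 (hp.1 l)
  exact ⟨o, ho, congrArg Pt.vertex hop⟩

lemma eq_none_of_fst_eq_zero (hne : ∀ z ∈ points ψ.1, z.1 ≠ 0) {o : Option (ℕ × ℕ)}
    (ho : LabelPresent (record enum ψ) o) (h0 : (labelPt (record enum ψ) a u o).1 = 0) :
    o = none := by
  cases o with
  | none => rfl
  | some κ => exact absurd h0 (hne _ (pointAt_mem ho).1)

/-- The edge from `v` to the origin is a face. Its later endpoint is the added point, so the edge
condition is a condition on the decoration `u` at the index given by the coordinates of `v`. -/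
lemma HasDistinctTimes.exists_neighbour (h : HasDistinctTimes enum ψ.1)
    (hne : ∀ z ∈ points ψ.1, z.1 ≠ 0) (hφ : IsConnectionFamily α φ) (hα : 1 ≤ α)
    {σ : Finset (Space d × 𝔸)} (hσ : σ ∈ (originComplex enum φ ψ.1 a u).faces)
    (h0 : ((0 : Space d), a) ∈ σ) {v : Space d × 𝔸} (hv : v ∈ σ) (hv0 : v ≠ (0, a)) :
    ∃ κ ∈ neighbours enum φ hα ψ a u, Pt.vertex (record enum ψ κ).1 = v := by
  classical
  set τ : Finset (Space d × 𝔸) := {v, (0, a)} with hτ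
  have hτK : τ ∈ (originComplex enum φ ψ.1 a u).faces := by
    refine ((originComplex enum φ ψ.1 a u).isRelLowerSet_faces hσ).2 ?_ ⟨v, by simp [hτ]⟩
    intro w hw
    rcases Finset.mem_insert.1 hw with rfl | hw
    · exact hv
    · rwa [Finset.mem_singleton.1 hw]
  have hmem : τ ∈ {σ ∈ (restrictTo (originComplex enum φ ψ.1 a u)
      (Set.univ ×ˢ Set.univ)).faces | σ.card = 1 + 1} :=
    ⟨⟨hτK, fun _ _ => ⟨trivial, trivial⟩⟩, Finset.card_pair hv0⟩
  rw [h.setOf_faces_eq Set.univ hα] at hmem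
  obtain ⟨T, ⟨hT, htime, -, -, hs⟩, himg⟩ := hmem
  have hval : ∀ w ∈ τ, ∃ l, Pt.vertex (labelPt (record enum ψ) a u (T l)) = w := by
    intro w hw
    rw [himg] at hw
    simpa using hw
  -- The added point has time `1` and cannot strictly precede another point.
  have htop : T 0 ≠ none := by
    intro hT0
    have := htime 0 1 (by simp)
    rw [hT0] at this
    exact absurd this (not_lt.2 unitInterval.le_one')
  obtain ⟨κ, hκ⟩ := Option.ne_none_iff_exists'.1 htop
  obtain ⟨l, hl⟩ := hval (0, a) (by simp [hτ])
  have hlnone : T l = none := eq_none_of_fst_eq_zero hne (hT l) (congrArg Prod.fst hl)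
  have hT1 : T 1 = none := by
    fin_cases l
    · exact absurd hlnone htop
    · exact hlnone
  obtain ⟨l', hl'⟩ := hval v (by simp [hτ])
  have hκv : Pt.vertex (record enum ψ κ).1 = v := by
    fin_cases l'
    · have h1 : Pt.vertex (labelPt (record enum ψ) a u (T 0)) = v := hl'
      rwa [hκ] at h1
    · have h1 : Pt.vertex (labelPt (record enum ψ) a u (T 1)) = v := hl'
      rw [hT1] at h1
      exact absurd h1.symm hv0
  refine ⟨κ, ⟨?_, ?_⟩, hκv⟩
  · have := hT 0
    rwa [hκ] at this
  · have hs' : Pt.decor (labelPt (record enum ψ) a u (T 1)) ⟨⟨0, hα⟩, fun i : Fin 1 =>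
        labelCoords (T i.castSucc)⟩ ≤
        -- The identity embedding selects the whole edge as the subset `ρ`.
        φ 1 (fun i => Pt.vertex (labelPt (record enum ψ) a u (T i))) :=
      hs ⟨0, hα⟩ (RelEmbedding.refl _)
    have hidx : (fun i : Fin 1 => labelCoords (T i.castSucc)) = fun _ => κ := by
      funext i
      have : i.castSucc = 0 := by fin_cases i; rfl
      rw [this, hκ]
      rfl
    have hφv : φ 1 (fun i => Pt.vertex (labelPt (record enum ψ) a u (T i))) =
        originProb φ a (Pt.vertex (record enum ψ κ).1) := by
      -- Time order puts the origin last, whereas `originProb` puts it first; symmetry of `φ 1`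
      -- exchanges the two.
      rw [originProb, ← hφ.symmetric 1 le_rfl hα (Equiv.swap 0 1)]
      congr 1
      funext i
      fin_cases i
      · change Pt.vertex (labelPt (record enum ψ) a u (T (Equiv.swap 0 1 0))) = (0, a)
        rw [Equiv.swap_apply_left, hT1]
        rfl
      · change Pt.vertex (labelPt (record enum ψ) a u (T (Equiv.swap 0 1 1))) = _
        rw [Equiv.swap_apply_right, hκ]
        rfl
    rw [hφv, hidx, hT1] at hs'
    exact hs'

/-- Erasing the origin from an `i`-simplex of its star leaves `i` vertices among the neighbours, and
reinserting it recovers the simplex. -/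
lemma HasDistinctTimes.originStar_finite_and_le (h : HasDistinctTimes enum ψ.1)
    (hne : ∀ z ∈ points ψ.1, z.1 ≠ 0) (hφ : IsConnectionFamily α φ) (hα : 1 ≤ α)
    (hfin : (neighbours enum φ hα ψ a u).Finite) (i : ℕ) :
    (originStar enum φ ψ.1 a u i).Finite ∧
      (originStar enum φ ψ.1 a u i).ncard ≤ (neighbours enum φ hα ψ a u).ncard ^ i := by
  classical
  set nb : Finset (Space d × 𝔸) := hfin.toFinset.image fun κ => Pt.vertex (record enum ψ κ).1
    with hnb
  have hsub : originStar enum φ ψ.1 a u i ⊆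
      ((nb.powersetCard i).image (insert ((0 : Space d), a)) : Finset (Finset (Space d × 𝔸))) := by
    rintro σ ⟨hσ, hcard, h0⟩
    rw [Finset.mem_coe, Finset.mem_image]
    refine ⟨σ.erase (0, a), Finset.mem_powersetCard.2 ⟨fun v hv => ?_, ?_⟩,
      Finset.insert_erase h0⟩
    · obtain ⟨hv0, hvσ⟩ := Finset.mem_erase.1 hv
      obtain ⟨κ, hκ, hκv⟩ := h.exists_neighbour hne hφ hα hσ h0 hvσ hv0
      exact Finset.mem_image.2 ⟨κ, hfin.mem_toFinset.2 hκ, hκv⟩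
    · rw [Finset.card_erase_of_mem h0, hcard, Nat.add_sub_cancel]
  refine ⟨(Finset.finite_toSet _).subset hsub, ?_⟩
  calc (originStar enum φ ψ.1 a u i).ncard
      ≤ ((nb.powersetCard i).image (insert ((0 : Space d), a))).card := by
        rw [← Set.ncard_coe_finset]
        exact Set.ncard_le_ncard hsub (Finset.finite_toSet _)
    _ ≤ (nb.powersetCard i).card := Finset.card_image_le
    _ = nb.card.choose i := Finset.card_powersetCard _ _
    _ ≤ nb.card ^ i := Nat.choose_le_pow _ _
    _ ≤ (neighbours enum φ hα ψ a u).ncard ^ i := by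
        refine Nat.pow_le_pow_left ?_ i
        rw [Set.ncard_eq_toFinset_card _ hfin]
        exact Finset.card_image_le

/-- Only finitely many points lie over a bounded window. Finiteness is needed to subtract
cardinalities. -/
lemma HasDistinctTimes.faces_finite (h : HasDistinctTimes enum ψ.1) {W : Set (Space d)}
    (hW : MeasurableSet W) (hWb : Bornology.IsBounded W) :
    (restrictTo (originComplex enum φ ψ.1 a u) (W ×ˢ Set.univ)).faces.Finite := by
  have hpts : (insert (originPt a u) (points ψ.1 ∩ W ×ˢ Set.univ)).Finite :=
    (ψ.2.1.finite_points (hW.prod MeasurableSet.univ) (ψ.2.2 W hW hWb).ne).insert _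
  have hv := hpts.image Pt.vertex
  refine (Finset.finite_toSet hv.toFinset.powerset).subset fun σ hσ => ?_
  rw [Finset.mem_coe, Finset.mem_powerset]
  intro v hvσ
  rw [Set.Finite.mem_toFinset]
  obtain ⟨o, ho, rfl⟩ := h.exists_label hσ.1 hvσ
  refine ⟨_, ?_, rfl⟩
  cases o with
  | none => exact Or.inl rfl
  | some κ => exact Or.inr ⟨(pointAt_mem ho).1, (hσ.2 _ hvσ).1, trivial⟩

/-- The difference operator of the Euler characteristic counts the simplices containing the added
vertex. -/
lemma HasDistinctTimes.diffOp_eulerChar (h : HasDistinctTimes enum ψ.1)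
    (hne : ∀ z ∈ points ψ.1, z.1 ≠ 0) {W : Set (Space d)}
    (hW : MeasurableSet W) (hWb : Bornology.IsBounded W) :
    diffOp enum φ eulerChar ψ.1 (0, a, 1, u) W =
      ∑ i ∈ Finset.range (α + 1), (-1 : ℝ) ^ i *
        (({σ ∈ originStar enum φ ψ.1 a u i | ∀ v ∈ σ, v ∈ W ×ˢ Set.univ}.ncard : ℕ) : ℝ) := by
  have hcard : ∀ S : Set (Space d × 𝔸), ∀ σ ∈ (restrictTo (originComplex enum φ ψ.1 a u) S).faces,
      σ.card ≤ α + 1 := fun S σ hσ => card_le_of_mem_originComplex hσ.1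
  change eulerChar (restrictTo (originComplex enum φ ψ.1 a u) (W ×ˢ Set.univ)) -
    eulerChar (restrictTo (originComplex enum φ ψ.1 a u) ((W \ {0}) ×ˢ Set.univ)) = _
  rw [eulerChar_eq_sum (hcard _), eulerChar_eq_sum (hcard _), ← Finset.sum_sub_distrib]
  refine Finset.sum_congr rfl fun i _ => ?_
  rw [← mul_sub]
  congr 1
  set A := {σ ∈ (restrictTo (originComplex enum φ ψ.1 a u) (W ×ˢ Set.univ)).faces |
    σ.card = i + 1}
  set B := {σ ∈ (restrictTo (originComplex enum φ ψ.1 a u) ((W \ {0}) ×ˢ Set.univ)).faces |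
    σ.card = i + 1}
  have hA : A.Finite := (h.faces_finite hW hWb).subset fun σ hσ => hσ.1
  have hBA : B ⊆ A := fun σ hσ =>
    ⟨⟨hσ.1.1, fun v hv => ⟨(hσ.1.2 v hv).1.1, trivial⟩⟩, hσ.2⟩
  -- A simplex over `W` is lost exactly when it has a vertex over `0`, and only the added vertex
  -- lies there.
  have hdiff : A \ B = {σ ∈ originStar enum φ ψ.1 a u i | ∀ v ∈ σ, v ∈ W ×ˢ Set.univ} := by
    ext σ
    constructor
    · rintro ⟨⟨⟨hσ, hσW⟩, hc⟩, hB⟩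
      refine ⟨⟨hσ, hc, ?_⟩, hσW⟩
      by_contra h0
      refine hB ⟨⟨hσ, fun v hv => ⟨⟨(hσW v hv).1, fun hv0 => h0 ?_⟩, trivial⟩⟩, hc⟩
      obtain ⟨o, ho, rfl⟩ := h.exists_label hσ hv
      obtain rfl := eq_none_of_fst_eq_zero hne ho hv0
      exact hv
    · rintro ⟨⟨hσ, hc, h0⟩, hσW⟩
      exact ⟨⟨⟨hσ, hσW⟩, hc⟩, fun hB => (hB.1.2 _ h0).1.2 rfl⟩
  rw [← hdiff, sub_eq_iff_eq_add]
  change (A.ncard : ℝ) = ((A \ B).ncard : ℝ) + (B.ncard : ℝ)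
  rw [← Set.ncard_sdiff_add_ncard_of_subset hBA hA]
  push_cast
  rfl

lemma HasDistinctTimes.enorm_diffOp_le (h : HasDistinctTimes enum ψ.1)
    (hne : ∀ z ∈ points ψ.1, z.1 ≠ 0) (hφ : IsConnectionFamily α φ) (hα : 1 ≤ α)
    {W : Set (Space d)} (hW : MeasurableSet W) (hWb : Bornology.IsBounded W) :
    ‖diffOp enum φ eulerChar ψ.1 (0, a, 1, u) W‖ₑ ≤
      (1 + degree φ hα (record enum ψ) a u) ^ α := by
  rw [degree_eq_encard]
  rcases (neighbours enum φ hα ψ a u).finite_or_infinite with hfin | hinf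
  swap
  · rw [hinf.encard_eq]
    simp [ENNReal.top_pow (show α ≠ 0 by omega)]
  rw [← hfin.cast_ncard_eq]
  set D := (neighbours enum φ hα ψ a u).ncard
  have hterm : ∀ i, {σ ∈ originStar enum φ ψ.1 a u i | ∀ v ∈ σ, v ∈ W ×ˢ Set.univ}.ncard ≤ D ^ i :=
    fun i => (Set.ncard_le_ncard (fun σ hσ => hσ.1)
      (h.originStar_finite_and_le hne hφ hα hfin i).1).trans
      (h.originStar_finite_and_le hne hφ hα hfin i).2
  rw [h.diffOp_eulerChar hne hW hWb]
  have hreal : |∑ i ∈ Finset.range (α + 1), (-1 : ℝ) ^ i *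
      (({σ ∈ originStar enum φ ψ.1 a u i | ∀ v ∈ σ, v ∈ W ×ˢ Set.univ}.ncard : ℕ) : ℝ)| ≤
      (((D + 1) ^ α : ℕ) : ℝ) := by
    refine (Finset.abs_sum_le_sum_abs _ _).trans ?_
    -- Each term `D ^ i` is at most the term `D ^ i * α.choose i` of the binomial expansion of `(D +
    -- 1) ^ α`.
    rw [add_pow, Nat.cast_sum]
    refine Finset.sum_le_sum fun i hi => ?_
    rw [abs_mul, abs_pow, abs_neg, abs_one, one_pow, one_mul, Nat.abs_cast, one_pow, mul_one]
    refine Nat.cast_le.2 ((hterm i).trans (Nat.le_mul_of_pos_right _ (Nat.choose_pos ?_)))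
    exact Nat.lt_succ_iff.1 (Finset.mem_range.1 hi)
  rw [Real.enorm_eq_ofReal_abs]
  refine (ENNReal.ofReal_le_ofReal hreal).trans (le_of_eq ?_)
  rw [ENNReal.ofReal_natCast]
  push_cast
  rw [add_comm]

/-- If the origin has finitely many potential neighbours, then the difference operator of the
Euler characteristic is eventually constant. -/
lemma HasDistinctTimes.tendsto_diffOp (h : HasDistinctTimes enum ψ.1)
    (hne : ∀ z ∈ points ψ.1, z.1 ≠ 0) (hφ : IsConnectionFamily α φ) (hα : 1 ≤ α)
    (hdeg : degree φ hα (record enum ψ) a u ≠ ∞)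
    {W : ℕ → Set (Space d)} (hW : ∀ n, IsCube (W n)) (hlim : TendsToSpace W) :
    Tendsto (fun n => diffOp enum φ eulerChar ψ.1 (0, a, 1, u) (W n)) atTop
      (𝓝 (∑ i ∈ Finset.range (α + 1), (-1 : ℝ) ^ i *
        ((originStar enum φ ψ.1 a u i).ncard : ℝ))) := by
  have hfin : (neighbours enum φ hα ψ a u).Finite := by
    rw [← Set.encard_ne_top_iff]
    intro htop
    rw [degree_eq_encard, htop] at hdeg
    simp at hdeg
  -- Once the window contains the origin and the finitely many neighbour positions, it excludes no
  -- simplex of the star.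
  have hB : (insert (0 : Space d)
      ((fun κ => (record enum ψ κ).1.1) '' neighbours enum φ hα ψ a u)).Finite :=
    (hfin.image _).insert _
  obtain ⟨N, hN⟩ := hlim _ hB.isBounded
  refine tendsto_const_nhds.congr' ?_
  filter_upwards [eventually_ge_atTop N] with n hn
  rw [h.diffOp_eulerChar hne (hW n).measurableSet (hW n).isBounded]
  refine Finset.sum_congr rfl fun i _ => ?_
  congr 3
  ext σ
  refine ⟨fun hσ => ⟨hσ, fun v hv => ⟨hN n hn ?_, trivial⟩⟩, fun hσ => hσ.1⟩
  by_cases hv0 : v = (0, a)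
  · rw [hv0]
    exact Or.inl rfl
  · obtain ⟨κ, hκ, rfl⟩ := h.exists_neighbour hne hφ hα hσ.1 hσ.2.2 hv hv0
    exact Or.inr ⟨κ, hκ, rfl⟩

end Star

/-! ### Measurability of the difference operator and auxiliary moment bounds. -/

section Conclusion

lemma one_add_pow_le (x : ℝ≥0∞) (m : ℕ) : (1 + x) ^ m ≤ 2 ^ m * (1 + x ^ m) := by
  calc (1 + x) ^ m ≤ (2 * max 1 x) ^ m := by
        gcongr
        rw [two_mul]
        exact add_le_add (le_max_left _ _) (le_max_right _ _)
    _ = 2 ^ m * max 1 x ^ m := mul_pow _ _ _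
    _ ≤ 2 ^ m * (1 + x ^ m) := by
        gcongr
        rcases le_total 1 x with h | h
        · rw [max_eq_right h]; exact le_add_self
        · rw [max_eq_left h, one_pow]; exact le_self_add

lemma lintegral_one_add_pow_lt_top {Ω : Type*} [MeasurableSpace Ω] {P : Measure Ω}
    [IsProbabilityMeasure P] {f : Ω → ℝ≥0∞} {m : ℕ} (hf : ∫⁻ ω, f ω ^ m ∂P < ∞) :
    ∫⁻ ω, (1 + f ω) ^ m ∂P < ∞ := by
  calc ∫⁻ ω, (1 + f ω) ^ m ∂P ≤ ∫⁻ ω, 2 ^ m * (1 + f ω ^ m) ∂P :=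
        lintegral_mono fun ω => one_add_pow_le _ _
    _ = 2 ^ m * (1 + ∫⁻ ω, f ω ^ m ∂P) := by
        rw [lintegral_const_mul' _ _ (by finiteness), lintegral_add_left measurable_const]
        simp
    _ < ∞ := by finiteness

variable {d α : ℕ} {𝔸 : Type*} [MeasurableSpace 𝔸] [StandardBorelSpace 𝔸]
  {enum : ℕ ≃ (Fin d → ℤ)} {φ : (j : ℕ) → (Fin (j + 1) → Space d × 𝔸) → unitInterval}

open Classical in
/-- The alternating sum of the numbers of labelled simplices over `W`. -/
def labelledEulerChar (φ : (j : ℕ) → (Fin (j + 1) → Space d × 𝔸) → unitInterval)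
    (W : Set (Space d)) (z : (ℕ × ℕ → Pt d 𝔸 α × Prop) × 𝔸 × Decor α) : ℝ :=
  ∑ i ∈ Finset.range (α + 1), (-1 : ℝ) ^ i *
    (({σ : Finset (Space d × 𝔸) | ∃ T : Fin (i + 1) → Option (ℕ × ℕ),
      IsLabelledSimplex φ W z.1 z.2.1 z.2.2 T ∧ σ = Finset.univ.image fun l =>
        Pt.vertex (labelPt z.1 z.2.1 z.2.2 (T l))}.ncard : ℕ) : ℝ)

lemma measurable_labelledEulerChar (hφ : IsConnectionFamily α φ) {W : Set (Space d)}
    (hW : MeasurableSet W) : Measurable (labelledEulerChar (α := α) φ W) :=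
  Finset.measurable_sum _ fun i _ => Measurable.const_mul
    ((measurable_from_nat (f := fun n : ℕ => (n : ℝ))).comp
      (measurable_ncard_labelledSimplex hφ hW i)) _

variable [Nonempty 𝔸]

lemma HasDistinctTimes.eulerChar_restrictTo {ψ : Config d 𝔸 α} (h : HasDistinctTimes enum ψ.1)
    (a : 𝔸) (u : Decor α) (W : Set (Space d)) :
    eulerChar (restrictTo (originComplex enum φ ψ.1 a u) (W ×ˢ Set.univ)) =
      labelledEulerChar φ W (record enum ψ, a, u) := by
  have hcard : ∀ σ ∈ (restrictTo (originComplex enum φ ψ.1 a u) (W ×ˢ Set.univ)).faces,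
      σ.card ≤ α + 1 := fun σ hσ => card_le_of_mem_originComplex hσ.1
  rw [eulerChar_eq_sum hcard]
  refine Finset.sum_congr rfl fun i hi => ?_
  rw [simplexCount, h.setOf_faces_eq _ (Nat.lt_succ_iff.1 (Finset.mem_range.1 hi))]

/-- Almost surely both Euler characteristics are measurable functions of the record, the mark and
the decoration. -/
lemma aemeasurable_diffOpOrigin {Ω : Type*} [MeasurableSpace Ω] {P : Measure Ω}
    (hφ : IsConnectionFamily α φ) {Ψ : Ω → Config d 𝔸 α} (hΨ : Measurable Ψ) {V : Ω → 𝔸}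
    (hV : Measurable V) {U : Ω → Decor α} (hU : Measurable U)
    (hdist : ∀ᵐ ω ∂P, HasDistinctTimes enum (Ψ ω).1) {W : Set (Space d)} (hW : MeasurableSet W) :
    AEMeasurable (diffOpOrigin enum φ (fun ω => (Ψ ω).1) V U eulerChar W) P := by
  have hz : Measurable fun ω => (record enum (Ψ ω), V ω, U ω) :=
    ((measurable_record enum).comp hΨ).prodMk (hV.prodMk hU)
  refine AEMeasurable.congr (f := fun ω =>
    labelledEulerChar φ W (record enum (Ψ ω), V ω, U ω) -
      labelledEulerChar φ (W \ {0}) (record enum (Ψ ω), V ω, U ω)) ?_ ?_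
  · exact (((measurable_labelledEulerChar hφ hW).comp hz).sub ((measurable_labelledEulerChar hφ
      (hW.diff (measurableSet_singleton 0))).comp hz)).aemeasurable
  · filter_upwards [hdist] with ω hω
    rw [← hω.eulerChar_restrictTo, ← hω.eulerChar_restrictTo]
    rfl

/-- One admissible sequence suffices to exhibit the limit `Z` as an almost everywhere limit of
measurable functions. -/
lemma exists_cubes_tendsToSpace (d : ℕ) :
    ∃ W : ℕ → Set (Space d), (∀ n, IsCube (W n)) ∧ TendsToSpace W := by
  refine ⟨fun n => {x | ∀ i, (WithLp.toLp 2 fun _ => -((n : ℝ) + 1) : Space d) i ≤ x i ∧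
    x i < (WithLp.toLp 2 fun _ => -((n : ℝ) + 1) : Space d) i + (2 * ((n : ℝ) + 1))},
    fun n => ⟨_, 2 * ((n : ℝ) + 1), by positivity, rfl⟩, fun B hB => ?_⟩
  obtain ⟨R, hR⟩ := hB.exists_norm_le
  obtain ⟨N, hN⟩ := exists_nat_ge R
  refine ⟨N, fun n hn x hx i => ?_⟩
  have h1 : |x i| ≤ n := by
    have := (PiLp.norm_apply_le x i).trans (hR x hx)
    rw [Real.norm_eq_abs] at this
    exact this.trans (hN.trans (by exact_mod_cast hn))
  have h2 := abs_le.1 h1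
  dsimp only
  constructor <;> linarith

end Conclusion

end RCM

end

/-! ### Both properties from the moment of order `3α` of the degree. -/

theorem mainTheorem8
    {d : ℕ} (hd : 1 ≤ d) {α : ℕ} (hα : 1 ≤ α)
    {𝔸 : Type*} [MeasurableSpace 𝔸] [StandardBorelSpace 𝔸]
    (Θ : Measure 𝔸) [IsProbabilityMeasure Θ]
    (γ : ℝ) (hγ : 0 < γ)
    (φ : (j : ℕ) → (Fin (j + 1) → RCM.Space d × 𝔸) → unitInterval)
    (hφ : RCM.IsConnectionFamily α φ)
    (enum : ℕ ≃ (Fin d → ℤ)) (henum : enum 0 = 0)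
    {Ω : Type*} [MeasurableSpace Ω] (P : Measure Ω) [IsProbabilityMeasure P]
    (Ψ : Ω → Measure (RCM.Pt d 𝔸 α))
    (hΨ : RCM.IsPoissonProcess Ψ (RCM.intensity d α γ Θ) P)
    (V : Ω → 𝔸) (hV : Measurable V) (hVlaw : P.map V = Θ)
    (U : Ω → RCM.Decor α) (hU : Measurable U) (hUlaw : P.map U = RCM.decorLaw α)
    (hVU : IndepFun V U P) (hΨVU : IndepFun Ψ (fun ω => (V ω, U ω)) P)
    (hmoment : ∫⁻ ω, RCM.mixingParam γ Θ φ (V ω) ^ (3 * (α : ℝ)) ∂P < ∞) :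
    RCM.IsWeaklyStabilizing P enum φ Ψ V U RCM.eulerChar ∧
      RCM.SatisfiesMomentCondition P enum φ Ψ V U RCM.eulerChar := by
  have : Nonempty 𝔸 := nonempty_of_isProbabilityMeasure Θ
  let Φ : Ω → RCM.Config d 𝔸 α := fun ω => ⟨Ψ ω, hΨ.counting ω, hΨ.locFinite ω⟩
  have hΦm : Measurable Φ := hΨ.measurable.subtype_mk
  -- Bundling the configuration as a subtype element does not change the generated σ-algebra, so
  -- independence carries over.
  have hΦVU : IndepFun Φ (fun ω => (V ω, U ω)) P := by
    rw [IndepFun_iff_Indep] at hΨVU ⊢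
    have : MeasurableSpace.comap Φ inferInstance = MeasurableSpace.comap Ψ inferInstance :=
      MeasurableSpace.comap_comp
    rwa [this]
  have hm : 3 * α ≠ 0 := by omega
  have hmoment' : ∫⁻ ω, RCM.mixingParam γ Θ φ (V ω) ^ (3 * α) ∂P < ∞ := by
    refine lt_of_le_of_lt (le_of_eq (lintegral_congr fun ω => ?_)) hmoment
    rw [← ENNReal.rpow_natCast]
    push_cast
    rfl
  have hdegree : ∫⁻ ω, RCM.degree φ hα (RCM.record enum (Φ ω)) (V ω) (U ω) ^ (3 * α) ∂P < ∞ :=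
    (RCM.lintegral_degree_pow_le hφ hα enum hΦm hΨ hV hVlaw hU hUlaw hVU hΦVU hm).trans_lt
      (ENNReal.mul_lt_top (RCM.degreeConst_ne_top _).lt_top
        (RCM.lintegral_one_add_pow_lt_top hmoment'))
  have hdist := hΨ.ae_hasDistinctTimes enum
  have hne := hΨ.ae_fst_ne hd 0
  have hz : Measurable fun ω => (RCM.record enum (Φ ω), V ω, U ω) :=
    ((RCM.measurable_record enum).comp hΦm).prodMk (hV.prodMk hU)
  have hfin : ∀ᵐ ω ∂P, RCM.degree φ hα (RCM.record enum (Φ ω)) (V ω) (U ω) ≠ ∞ := by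
    filter_upwards [ae_lt_top (((RCM.measurable_degree hφ hα).comp hz).pow_const (3 * α))
      hdegree.ne] with ω hω htop
    simp only [Function.comp_apply] at hω
    rw [htop, ENNReal.top_pow hm] at hω
    exact lt_irrefl _ hω
  have hmeas : ∀ W, RCM.IsCube W →
      AEMeasurable (RCM.diffOpOrigin enum φ Ψ V U RCM.eulerChar W) P := fun W hW =>
    RCM.aemeasurable_diffOpOrigin hφ hΦm hV hU hdist hW.measurableSet
  -- The choice `ε = 1` gives the exponent `3`, and `((1 + D) ^ α) ^ 3` is controlled by the moment
  -- of order `3 * α`.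
  refine ⟨⟨RCM.isTranslationInvariant_eulerChar, hmeas, ?_⟩, fun W hW _ => hmeas W hW, 1,
    one_pos, ?_⟩
  · set Z : Ω → ℝ := fun ω => ∑ i ∈ Finset.range (α + 1), (-1 : ℝ) ^ i *
      ((RCM.originStar enum φ (Ψ ω) (V ω) (U ω) i).ncard : ℝ)
    have hlim : ∀ W : ℕ → Set (RCM.Space d), (∀ n, RCM.IsCube (W n)) → RCM.TendsToSpace W →
        ∀ᵐ ω ∂P, Tendsto (fun n => RCM.diffOpOrigin enum φ Ψ V U RCM.eulerChar (W n) ω) atTop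
          (𝓝 (Z ω)) := by
      intro W hW hWlim
      filter_upwards [hdist, hne, hfin] with ω h1 h2 h3
      exact RCM.HasDistinctTimes.tendsto_diffOp (ψ := Φ ω) h1 h2 hφ hα h3 hW hWlim
    obtain ⟨W₀, hW₀, hW₀lim⟩ := RCM.exists_cubes_tendsToSpace d
    have hZ : AEMeasurable Z P :=
      aemeasurable_of_tendsto_metrizable_ae atTop (fun n => hmeas _ (hW₀ n)) (hlim W₀ hW₀ hW₀lim)
    -- `Z` is only almost everywhere measurable, so a measurable version serves as the limit; almost
    -- sure convergence to `Z` gives convergence in probability.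
    refine ⟨hZ.mk Z, hZ.measurable_mk, fun W hW hWlim => ?_⟩
    refine tendstoInMeasure_of_tendsto_ae (fun n => (hmeas _ (hW n)).aestronglyMeasurable) ?_
    filter_upwards [hlim W hW hWlim, hZ.ae_eq_mk] with ω h1 h2
    rwa [← h2]
  · refine lt_of_le_of_lt (iSup_le fun W => iSup_le fun hW => iSup_le fun _ => ?_)
      (RCM.lintegral_one_add_pow_lt_top hdegree)
    refine lintegral_mono_ae ?_
    filter_upwards [hdist, hne] with ω h1 h2
    have h3 := RCM.HasDistinctTimes.enorm_diffOp_le (ψ := Φ ω) (a := V ω) (u := U ω) h1 h2 hφ hα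
      hW.measurableSet hW.isBounded
    have h4 : (2 : ℝ) + 1 = ((3 : ℕ) : ℝ) := by norm_num
    rw [h4, ENNReal.rpow_natCast, mul_comm 3 α, pow_mul]
    exact pow_le_pow_left' h3 3
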